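/- For graphs $G$ and $H$ write $G\to(H)$ if every colouring of the edges of $G$ with two colours yields a copy of $H$ (as a not necessarily induced subgraph) whose edges all have the same colour, and $G\nrightarrow(H)$ otherwise. Let $G(n,p)$ be the binomial random graph on $n$ vertices, in which each pair of vertices is an edge independently with probability $p$. Graphs $G_n$ with $n$ vertices are taken on the same vertex set as $G(n,p)$, and a.a.s. means with probability tending to $1$ as $n\to\infty$. (i) Let $\gamma>0$ and $\varepsilon>0$. Let $(G_n)_{n\in\mathbb N}$ be any sequence of graphs such that $G_n$ has $n$ vertices and, for all sufficiently large $n$, at least $\gamma n^2$ edges, and let $p=p(n)\in[0,1]$ be any sequence with $p(n)\ge n^{-1/2+\varepsilon}$ for all sufficiently large $n$. Then a.a.s. $G_n\cup G(n,p)\to(K_4)$. (ii) Let $0<\gamma<\tfrac14$. Then there is a sequence $(G_n)_{n\in\mathbb N}$ of graphs, where $G_n$ has $n$ vertices and, for all sufficiently large $n$, at least $\gamma n^2$ edges, such that for every sequence $p=p(n)\in[0,1]$ with $p=o(n^{-1/2})$ we have a.a.s. $G_n\cup G(n,p)\nrightarrow(K_4)$. Moreover, $G_n$ can be taken to be the balanced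 complete bipartite graph $K_{\lceil n/2\rceil,\lfloor n/2\rfloor}$. -/

import Mathlib

open Filter Topology Asymptotics

namespace PerturbedRamsey

/-- `G → (H)`: every colouring of the edges of `G` with two colours yields a copy of `H` (a not
necessarily induced subgraph isomorphic to `H`) all of whose edges have the same colour.
`C.labelGraph i` is the spanning subgraph of `G` formed by the edges of colour `i`. -/
def Arrows {V W : Type*} (G : SimpleGraph V) (H : SimpleGraph W) : Prop :=
  ∀ C : G.EdgeLabeling (Fin 2), ∃ i : Fin 2, H.IsContained (C.labelGraph i)

/-- A finite graph `G = (V, E)` is `γ`-dense if `|E| ≥ γ |V|²`. -/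
def IsDense {V : Type*} [Finite V] (γ : ℝ) (G : SimpleGraph V) : Prop :=
  γ * (Nat.card V : ℝ) ^ 2 ≤ (G.edgeSet.ncard : ℝ)

/-- The binomial random graph `G(n, p n)` on the vertex set `Fin n` asymptotically almost surely
satisfies `P n`: the probability of this event tends to `1` as `n → ∞`. -/
def AAS (p : ℕ → unitInterval) (P : (n : ℕ) → SimpleGraph (Fin n) → Prop) : Prop :=
  Tendsto (fun n : ℕ => SimpleGraph.binomialRandom (Fin n) (p n) {R | P n R}) atTop (𝓝 1)

end PerturbedRamsey

/-! (i) Fix a colouring of G ∪ R. Sample t ≈ 2 log₂ n vertices of high degree in G, and let the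
record of a vertex b in colour c be the set of samples joined to b by an edge of G of colour c.
Counting the edges of G at the samples shows that for some colour c linearly many vertices have
dense records. If R is `Rich`, it has a K₄ on such vertices whose records pairwise intersect
substantially, and for a good sample (`exists_sample`) this forces linearly large common
c-neighbourhoods. Unless this K₄ is monochromatic in the other colour, it has an edge bb' of colour
c. A second use of `Rich` gives a K₄ of R inside the common c-neighbourhood of b and b'; it too is
monochromatic in the other colour or has an edge of colour c, which together with bb' spans a K₄ of
colour c.

Passing to records makes a union bound affordable: there are only 2^(tn) systems of records. For
each of them, Ramsey's theorem, supersaturation and Janson's inequality bound the failure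
probability by exp(-Ω(n⁴q⁶)), where q = n^(-1/2+η) and n⁴q⁶ = n^(1+6η) exceeds tn.

(ii) Let L be one side of the bipartite graph; edges within a side come from R. Outside L, colour R
without monochromatic triangles (`triangleColorable_of_locallySparse`). On L, take a vertex
colouring X and a pair colouring such that pairs with equal X get that colour and no K₄ of R is
monochromatic (`compatiblyColorable_of_locallySparse`). A crossing edge gets the colour opposite to
X at its end in L. A monochromatic K₄ cannot have two vertices in L and one outside, so it lies in L
or has three vertices outside, and both are excluded.

A minimal obstruction to either colouring is a system of overlapping cliques. Grown clique by
clique, it starts at most three edges short of twice its number of vertices and never falls further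
behind, so a few extra edges bring it to 2v edges on v vertices (`eq_empty_of_locallySparse`). The
exploration that finds such subgraphs has at most (Cn)^v states for each v, and (C n p²)^v sums to
o(1) when p = o(n^(-1/2)). -/

namespace PerturbedRamsey

set_option linter.unusedSectionVars false

/-! ### Random subsets: conditioning, correlation inequalities, Janson's inequality -/

section RandomSubset

open Finset

variable {ι : Type*} [Fintype ι] [DecidableEq ι]

/-- The probability that the `p`-random subset of `ι` equals `S`. -/
noncomputable def subsetWeight (p : ℝ) (S : Finset ι) : ℝ :=
  p ^ #S * (1 - p) ^ (Fintype.card ι - #S)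

/-- The expectation of `f` at the `p`-random subset of `ι`. -/
noncomputable def subsetExp (p : ℝ) (f : Finset ι → ℝ) : ℝ :=
  ∑ S, subsetWeight p S * f S

lemma subsetWeight_nonneg {p : ℝ} (h0 : 0 ≤ p) (h1 : p ≤ 1) (S : Finset ι) :
    0 ≤ subsetWeight p S :=
  mul_nonneg (pow_nonneg h0 _) (pow_nonneg (sub_nonneg.2 h1) _)

lemma sum_subsetWeight (p : ℝ) : ∑ S : Finset ι, subsetWeight p S = 1 := by
  simp [subsetWeight, Fintype.sum_pow_mul_eq_add_pow]

lemma subsetExp_const (p c : ℝ) : subsetExp p (fun _ : Finset ι => c) = c := by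
  rw [subsetExp, ← Finset.sum_mul, sum_subsetWeight, one_mul]

lemma subsetExp_mono {p : ℝ} (h0 : 0 ≤ p) (h1 : p ≤ 1) {f g : Finset ι → ℝ}
    (h : ∀ S, f S ≤ g S) : subsetExp p f ≤ subsetExp p g :=
  Finset.sum_le_sum fun S _ => mul_le_mul_of_nonneg_left (h S) (subsetWeight_nonneg h0 h1 S)

lemma subsetExp_add (p : ℝ) (f g : Finset ι → ℝ) :
    subsetExp p (fun S => f S + g S) = subsetExp p f + subsetExp p g := by
  simp only [subsetExp, mul_add, Finset.sum_add_distrib]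

lemma subsetExp_sub (p : ℝ) (f g : Finset ι → ℝ) :
    subsetExp p (fun S => f S - g S) = subsetExp p f - subsetExp p g := by
  simp only [subsetExp, mul_sub, Finset.sum_sub_distrib]

lemma subsetExp_sum {κ : Type*} (p : ℝ) (s : Finset κ) (f : κ → Finset ι → ℝ) :
    subsetExp p (fun S => ∑ k ∈ s, f k S) = ∑ k ∈ s, subsetExp p (f k) := by
  simp only [subsetExp, Finset.mul_sum]
  exact Finset.sum_comm

lemma subsetExp_nonneg {p : ℝ} (h0 : 0 ≤ p) (h1 : p ≤ 1) {f : Finset ι → ℝ}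
    (h : ∀ S, 0 ≤ f S) : 0 ≤ subsetExp p f :=
  Finset.sum_nonneg fun S _ => mul_nonneg (subsetWeight_nonneg h0 h1 S) (h S)

/-- Pair each set avoiding `a` with the set obtained by adding `a`: the two weights are in the ratio
1 - p to p. -/
lemma subsetExp_mem (p : ℝ) (a : ι) (f : Finset ι → ℝ) :
    subsetExp p (fun S => if a ∈ S then f S else 0) = p * subsetExp p (fun S => f (insert a S)) := by
  have key : ∀ g : Finset ι → ℝ, ∑ S, g S =
      ∑ S ∈ (univ.erase a).powerset, (g S + g (insert a S)) := by
    intro g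
    rw [Finset.sum_add_distrib, ← Finset.sum_powerset_insert (Finset.notMem_erase a univ),
      Finset.insert_erase (mem_univ a), Finset.powerset_univ]
  rw [subsetExp, subsetExp, key, key, Finset.mul_sum]
  refine Finset.sum_congr rfl fun S hS => ?_
  have ha : a ∉ S := fun h => Finset.notMem_erase a univ (Finset.mem_powerset.1 hS h)
  have hc : #S + 1 ≤ Fintype.card ι := by
    rw [← Finset.card_insert_of_notMem ha]; exact Finset.card_le_univ _
  obtain ⟨d, hd⟩ := Nat.exists_eq_add_of_le hc
  have h1 : Fintype.card ι - #S = d + 1 := by omega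
  have h2 : Fintype.card ι - (#S + 1) = d := by omega
  simp only [ha, if_false, Finset.mem_insert_self, if_true, Finset.insert_idem, subsetWeight,
    Finset.card_insert_of_notMem ha, h1, h2]
  ring

lemma subsetExp_subset (p : ℝ) (A : Finset ι) (f : Finset ι → ℝ) :
    subsetExp p (fun S => if A ⊆ S then f S else 0) =
      p ^ #A * subsetExp p (fun S => f (S ∪ A)) := by
  induction A using Finset.induction_on generalizing f with
  | empty => simp
  | insert a A ha ih =>
    have h : (fun S : Finset ι => if insert a A ⊆ S then f S else 0) =
        fun S => if A ⊆ S then (if a ∈ S then f S else 0) else 0 := by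
      funext S; by_cases h1 : a ∈ S <;> by_cases h2 : A ⊆ S <;> simp [Finset.insert_subset_iff, h1, h2]
    have h2 : (fun S : Finset ι => if a ∈ S ∪ A then f (S ∪ A) else 0) =
        fun S => if a ∈ S then f (S ∪ A) else 0 := by
      funext S; simp [ha]
    rw [h, ih, h2, subsetExp_mem p a (fun S => f (S ∪ A)), Finset.card_insert_of_notMem ha, pow_succ,
      mul_assoc]
    simp only [Finset.insert_union, Finset.union_insert]

lemma subsetExp_subset_one (p : ℝ) (A : Finset ι) :
    subsetExp p (fun S => if A ⊆ S then 1 else 0) = p ^ #A := by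
  rw [subsetExp_subset p A (fun _ => 1), subsetExp_const, mul_one]

/-- The lattice condition of the FKG inequality; for a product measure it is an equality. -/
lemma subsetWeight_mul_le (p : ℝ) (S T : Finset ι) :
    subsetWeight p S * subsetWeight p T ≤ subsetWeight p (S ⊓ T) * subsetWeight p (S ⊔ T) := by
  have h := Finset.card_inter_add_card_union S T
  have hS := Finset.card_le_univ S
  have hT := Finset.card_le_univ T
  have hI := Finset.card_le_univ (S ∩ T)
  have hU := Finset.card_le_univ (S ∪ T)
  have e : ∀ a b c d : ℕ, a ≤ Fintype.card ι → b ≤ Fintype.card ι → c ≤ Fintype.card ι →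
      d ≤ Fintype.card ι → a + b = c + d →
      p ^ a * (1 - p) ^ (Fintype.card ι - a) * (p ^ b * (1 - p) ^ (Fintype.card ι - b)) =
      p ^ c * (1 - p) ^ (Fintype.card ι - c) * (p ^ d * (1 - p) ^ (Fintype.card ι - d)) := by
    intro a b c d ha hb hc hd h
    have h' : (Fintype.card ι - a) + (Fintype.card ι - b) =
      (Fintype.card ι - c) + (Fintype.card ι - d) := by omega
    calc _ = p ^ (a + b) * (1 - p) ^ ((Fintype.card ι - a) + (Fintype.card ι - b)) := by ring
      _ = _ := by rw [h, h']; ring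
  exact (e _ _ _ _ hS hT hI hU h.symm).le

/-- **Harris' inequality** for decreasing functions with values in `[0, 1]`. -/
lemma subsetExp_mul_le_of_antitone {p : ℝ} (h0 : 0 ≤ p) (h1 : p ≤ 1) {f g : Finset ι → ℝ}
    (hf : Antitone f) (hg : Antitone g) (hf1 : ∀ S, f S ≤ 1) (hg1 : ∀ S, g S ≤ 1) :
    subsetExp p f * subsetExp p g ≤ subsetExp p (fun S => f S * g S) := by
  -- FKG concerns nonnegative increasing functions, so it is applied to the complements; the
  -- covariance is unchanged.
  have h := fkg (fun S => 1 - f S) (fun S => 1 - g S) (subsetWeight p)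
    (fun S => subsetWeight_nonneg h0 h1 S) (fun S => sub_nonneg.2 (hf1 S))
    (fun S => sub_nonneg.2 (hg1 S)) (fun S T hST => sub_le_sub_left (hf hST) 1)
    (fun S T hST => sub_le_sub_left (hg hST) 1) (subsetWeight_mul_le p)
  rw [sum_subsetWeight, one_mul] at h
  have e1 : subsetExp p (fun S => (1 - f S) * (1 - g S)) =
      1 - subsetExp p f - subsetExp p g + subsetExp p (fun S => f S * g S) := by
    rw [← subsetExp_const (ι := ι) p 1, ← subsetExp_sub, ← subsetExp_sub, ← subsetExp_add]
    congr 1; funext S; rw [subsetExp_const]; ring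
  change subsetExp p (fun S => 1 - f S) * subsetExp p (fun S => 1 - g S) ≤
    subsetExp p (fun S => (1 - f S) * (1 - g S)) at h
  rw [e1, subsetExp_sub, subsetExp_sub, subsetExp_const] at h
  linarith

/-- The expectation of an increasing function increases with the density. -/
lemma subsetExp_le_of_monotone {p q : ℝ} (hq : 0 < q) (hq1 : q < 1) (hqp : q ≤ p) (hp : p ≤ 1)
    {g : Finset ι → ℝ} (hg : Monotone g) (hg0 : ∀ S, 0 ≤ g S) :
    subsetExp q g ≤ subsetExp p g := by
  set N := Fintype.card ι
  -- The density of the `p`-random set relative to the `q`-random set. It is increasing since q ≤ p,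
  -- hence positively correlated with `g`.
  set f : Finset ι → ℝ := fun S => (p / q) ^ #S * ((1 - p) / (1 - q)) ^ (N - #S) with hf
  have hp0 : 0 ≤ p := hq.le.trans hqp
  have a1 : 1 ≤ p / q := (one_le_div hq).2 hqp
  have b0 : 0 ≤ (1 - p) / (1 - q) := div_nonneg (by linarith) (by linarith)
  have b1 : (1 - p) / (1 - q) ≤ 1 := (div_le_one (by linarith)).2 (by linarith)
  have hmul : ∀ S, subsetWeight q S * f S = subsetWeight p S := by
    intro S
    have : (1 - q) ≠ 0 := by linarith
    simp only [hf, subsetWeight, div_pow]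
    change q ^ #S * (1 - q) ^ (N - #S) * _ = p ^ #S * (1 - p) ^ (N - #S)
    field_simp
  have hfm : Monotone f := by
    intro S T hST
    have := Finset.card_le_card hST
    exact mul_le_mul (pow_le_pow_right₀ a1 this) (pow_le_pow_of_le_one b0 b1 (by omega))
      (pow_nonneg b0 _) (pow_nonneg (by linarith) _)
  have h := fkg f g (subsetWeight q) (fun S => subsetWeight_nonneg hq.le hq1.le S)
    (fun S => mul_nonneg (pow_nonneg (by linarith) _) (pow_nonneg b0 _)) hg0 hfm hg
    (subsetWeight_mul_le q)
  simp only [← mul_assoc, hmul] at h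
  rw [sum_subsetWeight, sum_subsetWeight, one_mul, one_mul] at h
  exact h

lemma antitone_ite_forall_not_subset {κ : Type*} (s : Finset κ) (A : κ → Finset ι) (B : Finset ι) :
    Antitone (fun S : Finset ι => if ∀ k ∈ s, ¬ A k ⊆ S ∪ B then (1 : ℝ) else 0) := by
  intro S T hST
  by_cases h : ∀ k ∈ s, ¬ A k ⊆ T ∪ B
  · have h' : ∀ k ∈ s, ¬ A k ⊆ S ∪ B := fun k hk hs =>
      h k hk (hs.trans (Finset.union_subset_union_left hST))
    simp only [if_pos h, if_pos h', le_refl]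
  · simp only [if_neg h]; split_ifs <;> norm_num

/-- A version of **Janson's inequality**: if every member of a family of `m`-element sets is in
expectation met by at most half a further member, given that it is present, then the random set
misses all members with probability at most `(1 - p ^ m / 2)` to the number of members. -/
theorem subsetExp_forall_not_subset_le {κ : Type*} [DecidableEq κ] {p : ℝ} (h0 : 0 ≤ p)
    (h1 : p ≤ 1) {m : ℕ} (s : Finset κ) (A : κ → Finset ι) (hA : ∀ k ∈ s, #(A k) = m)
    (hD : ∀ k ∈ s, ∑ l ∈ s with l ≠ k ∧ ¬ Disjoint (A l) (A k), p ^ #(A l \ A k) ≤ 1 / 2) :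
    subsetExp p (fun S => if ∀ k ∈ s, ¬ A k ⊆ S then (1 : ℝ) else 0) ≤ (1 - p ^ m / 2) ^ #s := by
  induction s using Finset.induction_on with
  | empty => simp [subsetExp_const]
  | insert a s ha ih =>
    have hpm0 : 0 ≤ p ^ m := pow_nonneg h0 _
    have hpm1 : p ^ m ≤ 1 := pow_le_one₀ h0 h1
    have ih' := ih (fun k hk => hA k (mem_insert_of_mem hk)) (fun k hk => by
      refine le_trans ?_ (hD k (mem_insert_of_mem hk))
      exact Finset.sum_le_sum_of_subset_of_nonneg
        (Finset.filter_subset_filter _ (Finset.subset_insert _ _))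
        (fun _ _ _ => pow_nonneg h0 _))
    set X := subsetExp p (fun S => if ∀ k ∈ s, ¬ A k ⊆ S then (1 : ℝ) else 0) with hX
    have hX0 : 0 ≤ X := subsetExp_nonneg h0 h1 fun S => by split_ifs <;> norm_num
    -- the members of `s` meeting `A a`, and the others
    set sD := s.filter (fun l => ¬ Disjoint (A l) (A a)) with hsD
    set sC := s.filter (fun l => Disjoint (A l) (A a)) with hsC
    have hsplit : ∀ S : Finset ι, (∀ k ∈ s, ¬ A k ⊆ S) ↔
        (∀ k ∈ sC, ¬ A k ⊆ S) ∧ (∀ k ∈ sD, ¬ A k ⊆ S) := by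
      intro S
      simp only [hsD, hsC, mem_filter]
      constructor
      · exact fun h => ⟨fun k hk => h k hk.1, fun k hk => h k hk.1⟩
      · intro h k hk
        by_cases hd : Disjoint (A k) (A a)
        exacts [h.1 k ⟨hk, hd⟩, h.2 k ⟨hk, hd⟩]
    have hC : ∀ S : Finset ι, (∀ k ∈ sC, ¬ A k ⊆ S ∪ A a) ↔ ∀ k ∈ sC, ¬ A k ⊆ S := by
      intro S
      refine forall₂_congr fun k hk => not_congr ?_
      have hd : Disjoint (A k) (A a) := (mem_filter.1 hk).2
      exact ⟨fun h => hd.left_le_of_le_sup_right h, fun h => h.trans subset_union_left⟩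
    -- Conditioning on `A a ⊆ S` costs `p ^ m`. Harris then separates the members disjoint from `A
    -- a`, which do not feel the conditioning, from those meeting it, which are all missed with
    -- probability at least 1/2 by the union bound.
    have hY : p ^ m / 2 * X ≤
        subsetExp p (fun S => if A a ⊆ S then (if ∀ k ∈ s, ¬ A k ⊆ S then (1 : ℝ) else 0) else 0) := by
      rw [subsetExp_subset, hA a (mem_insert_self _ _)]
      have hprod : (fun S : Finset ι => if ∀ k ∈ s, ¬ A k ⊆ S ∪ A a then (1 : ℝ) else 0) =
          fun S => (if ∀ k ∈ sC, ¬ A k ⊆ S ∪ A a then (1 : ℝ) else 0) *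
            (if ∀ k ∈ sD, ¬ A k ⊆ S ∪ A a then (1 : ℝ) else 0) := by
        funext S
        rw [if_congr (hsplit (S ∪ A a)) rfl rfl, ite_and, ite_mul, one_mul, zero_mul]
      have hH := subsetExp_mul_le_of_antitone h0 h1
        (antitone_ite_forall_not_subset sC A (A a)) (antitone_ite_forall_not_subset sD A (A a))
        (fun S => by split_ifs <;> norm_num) (fun S => by split_ifs <;> norm_num)
      have h3 : X ≤ subsetExp p (fun S => if ∀ k ∈ sC, ¬ A k ⊆ S ∪ A a then (1 : ℝ) else 0) := by
        refine subsetExp_mono h0 h1 fun S => ?_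
        by_cases h : ∀ k ∈ s, ¬ A k ⊆ S
        · have h' : ∀ k ∈ sC, ¬ A k ⊆ S ∪ A a := (hC S).2 ((hsplit S).1 h).1
          simp only [if_pos h, if_pos h', le_refl]
        · simp only [if_neg h]; split_ifs <;> norm_num
      have h4 : 1 / 2 ≤
          subsetExp p (fun S => if ∀ k ∈ sD, ¬ A k ⊆ S ∪ A a then (1 : ℝ) else 0) := by
        have h5 : (1 : ℝ) - ∑ k ∈ sD, p ^ #(A k \ A a) ≤
            subsetExp p (fun S => if ∀ k ∈ sD, ¬ A k ⊆ S ∪ A a then (1 : ℝ) else 0) := by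
          have : (1 : ℝ) - ∑ k ∈ sD, p ^ #(A k \ A a) = subsetExp p (fun S : Finset ι =>
              1 - ∑ k ∈ sD, if A k \ A a ⊆ S then (1 : ℝ) else 0) := by
            rw [subsetExp_sub, subsetExp_const, subsetExp_sum]
            simp only [subsetExp_subset_one]
          rw [this]
          refine subsetExp_mono h0 h1 fun S => ?_
          by_cases h : ∀ k ∈ sD, ¬ A k ⊆ S ∪ A a
          · simp only [if_pos h]
            exact sub_le_self _ (Finset.sum_nonneg fun _ _ => by split_ifs <;> norm_num)
          · simp only [if_neg h]
            push Not at h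
            obtain ⟨k, hk, hks⟩ := h
            have hks' : A k \ A a ⊆ S := by
              rw [sdiff_le_iff, sup_comm]; exact hks
            have := Finset.single_le_sum (f := fun k => if A k \ A a ⊆ S then (1 : ℝ) else 0)
              (fun _ _ => by positivity) hk
            simp only [hks', if_true] at this
            linarith
        have h6 := hD a (mem_insert_self _ _)
        have h7 : ∑ k ∈ sD, p ^ #(A k \ A a) ≤ 1 / 2 := by
          refine le_trans (Finset.sum_le_sum_of_subset_of_nonneg ?_ (fun _ _ _ => pow_nonneg h0 _)) h6
          intro k hk
          obtain ⟨hk1, hk2⟩ := mem_filter.1 hk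
          exact mem_filter.2 ⟨mem_insert_of_mem hk1, fun h => ha (h ▸ hk1), hk2⟩
        linarith
      rw [hprod]
      calc p ^ m / 2 * X = p ^ m * (X * (1 / 2)) := by ring
        _ ≤ _ := mul_le_mul_of_nonneg_left
          ((mul_le_mul h3 h4 (by norm_num) (hX0.trans h3)).trans hH) hpm0
    have hZ : subsetExp p (fun S => if ∀ k ∈ insert a s, ¬ A k ⊆ S then (1 : ℝ) else 0) =
        X - subsetExp p (fun S =>
          if A a ⊆ S then (if ∀ k ∈ s, ¬ A k ⊆ S then (1 : ℝ) else 0) else 0) := by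
      rw [hX, ← subsetExp_sub]
      congr 1; funext S
      rw [if_congr (Finset.forall_mem_insert ..) rfl rfl]
      by_cases h1 : A a ⊆ S <;> simp [h1]
    rw [hZ, Finset.card_insert_of_notMem ha, pow_succ]
    have : (1 - p ^ m / 2) * X ≤ (1 - p ^ m / 2) * (1 - p ^ m / 2) ^ #s :=
      mul_le_mul_of_nonneg_left ih' (by linarith)
    nlinarith

end RandomSubset

/-! ### The binomial random graph as a random set of pairs -/

section RandomGraph

open Finset MeasureTheory

variable {V : Type*} [Fintype V] [DecidableEq V]

/-- The graph whose edges are the given pairs of distinct vertices. -/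
def pairGraph (S : Finset {e : Sym2 V // ¬ e.IsDiag}) : SimpleGraph V :=
  SimpleGraph.fromEdgeSet (Subtype.val '' (S : Set {e : Sym2 V // ¬ e.IsDiag}))

lemma mem_edgeSet_pairGraph {S : Finset {e : Sym2 V // ¬ e.IsDiag}} {e : Sym2 V} :
    e ∈ (pairGraph S).edgeSet ↔ ∃ h : ¬ e.IsDiag, (⟨e, h⟩ : {e : Sym2 V // ¬ e.IsDiag}) ∈ S := by
  rw [pairGraph, SimpleGraph.edgeSet_fromEdgeSet]
  constructor
  · rintro ⟨⟨⟨e, h⟩, hS, rfl⟩, -⟩; exact ⟨h, hS⟩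
  · rintro ⟨h, hS⟩; exact ⟨⟨⟨e, h⟩, hS, rfl⟩, h⟩

lemma ncard_edgeSet_pairGraph (S : Finset {e : Sym2 V // ¬ e.IsDiag}) :
    (pairGraph S).edgeSet.ncard = #S := by
  have : (pairGraph S).edgeSet = Subtype.val '' (S : Set {e : Sym2 V // ¬ e.IsDiag}) := by
    ext e; rw [mem_edgeSet_pairGraph]; simp
  rw [this, Set.ncard_image_of_injective _ Subtype.val_injective, Set.ncard_coe_finset]

lemma pairGraph_bijective :
    Function.Bijective (pairGraph : Finset {e : Sym2 V // ¬ e.IsDiag} → SimpleGraph V) := by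
  classical
  constructor
  · intro S T h
    ext ⟨e, he⟩
    have : e ∈ (pairGraph S).edgeSet ↔ e ∈ (pairGraph T).edgeSet := by rw [h]
    simpa [mem_edgeSet_pairGraph, he] using this
  · intro G
    refine ⟨univ.filter fun e => e.1 ∈ G.edgeSet, ?_⟩
    apply SimpleGraph.edgeSet_injective
    ext e
    rw [mem_edgeSet_pairGraph]
    constructor
    · rintro ⟨h, hm⟩; exact (mem_filter.1 hm).2
    · intro h; exact ⟨G.not_isDiag_of_mem_edgeSet h, mem_filter.2 ⟨mem_univ _, h⟩⟩

instance : MeasurableSingletonClass (SimpleGraph V) where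
  measurableSet_singleton G := by
    have h := (measurableSet_singleton G.edgeSet).preimage
      (SimpleGraph.measurable_edgeSet (V := V))
    convert h
    ext H
    simp

/-- Graphs correspond bijectively to sets of non-diagonal pairs with equal weights, so the
inequalities for random subsets become available. -/
lemma binomialRandom_real_eq (p : unitInterval) {P : SimpleGraph V → Prop}
    {P' : Finset {e : Sym2 V // ¬ e.IsDiag} → Prop} [DecidablePred P']
    (h : ∀ S, P (pairGraph S) ↔ P' S) :
    (SimpleGraph.binomialRandom V p).real {R | P R} =
      subsetExp (p : ℝ) (fun S => if P' S then 1 else 0) := by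
  classical
  have h1 : ({R | P R} : Set (SimpleGraph V)) = ↑((univ : Finset (SimpleGraph V)).filter P) := by
    ext; simp
  rw [h1, ← sum_measureReal_singleton, Finset.sum_filter, subsetExp]
  symm
  refine Fintype.sum_bijective pairGraph pairGraph_bijective _ _ fun S => ?_
  rw [mul_ite, mul_one, mul_zero]
  simp only [← h]
  congr 1
  rw [Measure.real, SimpleGraph.binomialRandom_singleton, ncard_edgeSet_pairGraph, subsetWeight,
    Nat.card_eq_fintype_card, Sym2.card_subtype_not_diag]
  simp

lemma binomialRandom_real_subset_le (p : unitInterval) (E : Finset (Sym2 V)) :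
    (SimpleGraph.binomialRandom V p).real {R | (E : Set (Sym2 V)) ⊆ R.edgeSet} ≤ (p : ℝ) ^ #E := by
  classical
  by_cases hE : ∃ e ∈ E, e.IsDiag
  · obtain ⟨e, he, hd⟩ := hE
    have : {R : SimpleGraph V | (E : Set (Sym2 V)) ⊆ R.edgeSet} = ∅ := by
      ext R
      simp only [Set.mem_ofPred_eq, Set.mem_empty_iff_false, iff_false]
      exact fun h => R.not_isDiag_of_mem_edgeSet (h he) hd
    rw [this]; simp only [measureReal_empty]; exact pow_nonneg p.2.1 _
  · push Not at hE
    rw [binomialRandom_real_eq p fun _ => Iff.rfl, ← show #(E.subtype fun e => ¬ e.IsDiag) = #E by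
      rw [Finset.card_subtype, Finset.filter_true_of_mem hE], ← subsetExp_subset_one]
    refine subsetExp_mono p.2.1 p.2.2 fun S => ?_
    refine le_of_eq (if_congr ?_ rfl rfl)
    constructor
    · intro h x hx
      obtain ⟨_, h2⟩ := mem_edgeSet_pairGraph.1 (h (Finset.mem_coe.2 (Finset.mem_subtype.1 hx)))
      exact h2
    · intro h e he
      exact mem_edgeSet_pairGraph.2 ⟨hE e he, h (Finset.mem_subtype.2 he)⟩

/-- Union bound. -/
lemma binomialRandom_real_exists_le {κ : Type*} (p : unitInterval) (s : Finset κ)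
    (P : κ → SimpleGraph V → Prop) :
    (SimpleGraph.binomialRandom V p).real {R | ∃ k ∈ s, P k R} ≤
      ∑ k ∈ s, (SimpleGraph.binomialRandom V p).real {R | P k R} := by
  have : ({R | ∃ k ∈ s, P k R} : Set (SimpleGraph V)) = ⋃ k ∈ s, {R | P k R} := by
    ext; simp
  rw [this]
  exact measureReal_biUnion_finset_le _ _

end RandomGraph

lemma aas_of_tendsto {p : ℕ → unitInterval} {P : (n : ℕ) → SimpleGraph (Fin n) → Prop}
    (b : ℕ → ℝ) (hb : Tendsto b atTop (𝓝 0))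
    (h : ∀ᶠ n in atTop, (SimpleGraph.binomialRandom (Fin n) (p n)).real {R | ¬ P n R} ≤ b n) :
    AAS p P := by
  unfold AAS
  have key : ∀ n, SimpleGraph.binomialRandom (Fin n) (p n) {R | P n R} =
      ENNReal.ofReal (1 - (SimpleGraph.binomialRandom (Fin n) (p n)).real {R | ¬ P n R}) := by
    intro n
    have hc : ({R | ¬ P n R} : Set (SimpleGraph (Fin n))) = {R | P n R}ᶜ := by ext; simp
    rw [hc, MeasureTheory.measureReal_compl (Set.toFinite _).measurableSet]
    simp
  have h0 : Tendsto (fun n => (SimpleGraph.binomialRandom (Fin n) (p n)).real {R | ¬ P n R}) atTop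
      (𝓝 0) :=
    tendsto_of_tendsto_of_tendsto_of_le_of_le' tendsto_const_nhds hb
      (Eventually.of_forall fun n => MeasureTheory.measureReal_nonneg) h
  simp_rw [key]
  have := (ENNReal.continuous_ofReal.tendsto (1 - 0)).comp (tendsto_const_nhds.sub h0)
  rw [sub_zero, ENNReal.ofReal_one] at this
  exact this

/-! ### Random graphs missing a family of four-cliques -/

section Cliques

open Finset MeasureTheory

variable {V : Type*} [Fintype V] [DecidableEq V]

/-- The pairs of distinct vertices inside `Q`. -/
def pairsIn (Q : Finset V) : Finset {e : Sym2 V // ¬ e.IsDiag} :=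
  univ.filter fun e => ∀ v ∈ e.1, v ∈ Q

lemma mem_pairsIn {Q : Finset V} {e : {e : Sym2 V // ¬ e.IsDiag}} :
    e ∈ pairsIn Q ↔ ∀ v ∈ e.1, v ∈ Q := by
  simp [pairsIn]

lemma card_pairsIn (Q : Finset V) : #(pairsIn Q) = (#Q).choose 2 := by
  rw [← Sym2.card_image_offDiag, ← Finset.card_image_of_injective (pairsIn Q) Subtype.val_injective]
  congr 1
  ext e
  induction e using Sym2.ind with
  | _ x y =>
    simp only [mem_image, mem_pairsIn, Subtype.exists, exists_and_right, exists_eq_right,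
      Prod.exists, mem_offDiag, Function.uncurry_apply_pair]
    constructor
    · rintro ⟨h1, h2⟩
      exact ⟨x, y, ⟨h2 x (Sym2.mem_mk_left x y), h2 y (Sym2.mem_mk_right x y), h1⟩, rfl⟩
    · rintro ⟨a, b, ⟨ha, hb, hab⟩, h⟩
      rw [← h]
      refine ⟨hab, fun v hv => ?_⟩
      rcases Sym2.mem_iff.1 hv with rfl | rfl <;> assumption

lemma pairsIn_inter (Q Q' : Finset V) : pairsIn Q ∩ pairsIn Q' = pairsIn (Q ∩ Q') := by
  ext e
  simp only [mem_inter, mem_pairsIn]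
  exact ⟨fun h v hv => ⟨h.1 v hv, h.2 v hv⟩, fun h => ⟨fun v hv => (h v hv).1, fun v hv => (h v hv).2⟩⟩

lemma isClique_pairGraph_iff {S : Finset {e : Sym2 V // ¬ e.IsDiag}} {Q : Finset V} :
    (pairGraph S).IsClique Q ↔ pairsIn Q ⊆ S := by
  constructor
  · rintro h ⟨e, he⟩ hQ
    induction e using Sym2.ind with
    | _ x y =>
      have h1 := mem_pairsIn.1 hQ
      have h2 : (pairGraph S).Adj x y :=
        h (h1 x (Sym2.mem_mk_left x y)) (h1 y (Sym2.mem_mk_right x y)) he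
      obtain ⟨_, h3⟩ := mem_edgeSet_pairGraph.1 ((SimpleGraph.mem_edgeSet _).2 h2)
      exact h3
  · intro h x hx y hy hxy
    rw [← SimpleGraph.mem_edgeSet, mem_edgeSet_pairGraph]
    refine ⟨hxy, h (mem_pairsIn.2 fun v hv => ?_)⟩
    rcases Sym2.mem_iff.1 hv with rfl | rfl <;> assumption

/-- `Q'` is determined by its part inside `Q` and its part outside. -/
lemma card_filter_card_inter_le (F : Finset (Finset V)) (hF : ∀ Q ∈ F, #Q = 4) {Q : Finset V}
    (hQ : #Q = 4) (j : ℕ) :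
    #(F.filter fun Q' => #(Q' ∩ Q) = j) ≤ Nat.choose 4 j * Fintype.card V ^ (4 - j) := by
  calc #(F.filter fun Q' => #(Q' ∩ Q) = j)
      ≤ #(powersetCard j Q ×ˢ powersetCard (4 - j) (univ : Finset V)) := by
        refine Finset.card_le_card_of_injOn (fun Q' => (Q' ∩ Q, Q' \ Q)) ?_ ?_
        · intro Q' hQ'
          obtain ⟨h1, h2⟩ := mem_filter.1 hQ'
          have h3 := Finset.card_inter_add_card_sdiff Q' Q
          have h4 := hF _ h1
          simp only [coe_product, Set.mem_prod, mem_coe, mem_powersetCard, subset_univ, true_and]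
          exact ⟨⟨inter_subset_right, h2⟩, by omega⟩
        · intro A _ B _ h
          simp only [Prod.mk.injEq] at h
          rw [← Finset.sdiff_union_inter A Q, h.1, h.2, Finset.sdiff_union_inter]
    _ ≤ _ := by
        rw [card_product, card_powersetCard, card_powersetCard, hQ, card_univ]
        exact Nat.mul_le_mul_left _ (Nat.choose_le_pow _ _)

/-- The correlation term of Janson's inequality. Distinct quadruples sharing a pair meet in two
vertices (one common pair, five new ones) or in three (three common pairs, three new ones). -/
lemma sum_pow_card_pairsIn_sdiff_le {q : ℝ} (h0 : 0 ≤ q)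
    (F : Finset (Finset V)) (hF : ∀ Q ∈ F, #Q = 4) {Q : Finset V} (hQ : #Q = 4) :
    ∑ Q' ∈ F with Q' ≠ Q ∧ ¬ Disjoint (pairsIn Q') (pairsIn Q), q ^ #(pairsIn Q' \ pairsIn Q) ≤
      6 * (Fintype.card V : ℝ) ^ 2 * q ^ 5 + 4 * (Fintype.card V : ℝ) * q ^ 3 := by
  have hsub : F.filter (fun Q' => Q' ≠ Q ∧ ¬ Disjoint (pairsIn Q') (pairsIn Q)) ⊆
      F.filter (fun Q' => #(Q' ∩ Q) = 2) ∪ F.filter (fun Q' => #(Q' ∩ Q) = 3) := by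
    intro Q' h
    obtain ⟨h1, h2, h3⟩ := mem_filter.1 h
    rw [Finset.disjoint_iff_inter_eq_empty, pairsIn_inter, ← Finset.card_eq_zero, card_pairsIn] at h3
    have h4 : 2 ≤ #(Q' ∩ Q) := by
      by_contra hlt
      exact h3 (Nat.choose_eq_zero_of_lt (by omega))
    have h5 : #(Q' ∩ Q) < 4 := by
      rw [← hF _ h1]
      refine Finset.card_lt_card (Finset.ssubset_iff_subset_ne.2 ⟨inter_subset_left, fun h => h2 ?_⟩)
      exact Finset.eq_of_subset_of_card_le (Finset.inter_eq_left.1 h) (by rw [hF _ h1, hQ])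
    rw [mem_union, mem_filter, mem_filter]
    rcases (by omega : #(Q' ∩ Q) = 2 ∨ #(Q' ∩ Q) = 3) with h | h
    exacts [Or.inl ⟨h1, h⟩, Or.inr ⟨h1, h⟩]
  have hcard : ∀ Q' ∈ F, #(pairsIn Q' \ pairsIn Q) = 6 - (#(Q' ∩ Q)).choose 2 := by
    intro Q' h
    have := Finset.card_inter_add_card_sdiff (pairsIn Q') (pairsIn Q)
    rw [pairsIn_inter, card_pairsIn, card_pairsIn, hF _ h] at this
    have h6 : Nat.choose 4 2 = 6 := rfl
    omega
  have hpart : ∀ j e : ℕ, 6 - j.choose 2 = e →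
      ∑ Q' ∈ F with #(Q' ∩ Q) = j, q ^ #(pairsIn Q' \ pairsIn Q) ≤
        (Nat.choose 4 j * Fintype.card V ^ (4 - j) : ℕ) * q ^ e := by
    intro j e he
    rw [Finset.sum_congr rfl (g := fun _ => q ^ e) fun Q' hQ' => by
      obtain ⟨h1, h2⟩ := mem_filter.1 hQ'
      rw [hcard _ h1, h2, he], sum_const, nsmul_eq_mul]
    exact mul_le_mul_of_nonneg_right (by exact_mod_cast card_filter_card_inter_le F hF hQ j)
      (pow_nonneg h0 _)
  calc _ ≤ ∑ Q' ∈ F.filter (fun Q' => #(Q' ∩ Q) = 2) ∪ F.filter (fun Q' => #(Q' ∩ Q) = 3),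
        q ^ #(pairsIn Q' \ pairsIn Q) :=
        Finset.sum_le_sum_of_subset_of_nonneg hsub fun _ _ _ => pow_nonneg h0 _
    _ ≤ ∑ Q' ∈ F with #(Q' ∩ Q) = 2, q ^ #(pairsIn Q' \ pairsIn Q) +
        ∑ Q' ∈ F with #(Q' ∩ Q) = 3, q ^ #(pairsIn Q' \ pairsIn Q) := by
        rw [← Finset.sum_union_inter]
        exact le_add_of_nonneg_right (Finset.sum_nonneg fun _ _ => pow_nonneg h0 _)
    _ ≤ _ := by
        refine (add_le_add (hpart 2 5 rfl) (hpart 3 3 rfl)).trans (le_of_eq ?_)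
        have : Nat.choose 4 2 = 6 := rfl
        have h' : Nat.choose 4 3 = 4 := rfl
        rw [this, h']; push_cast; ring

/-- A random graph of density at least `q` is unlikely to miss all cliques of a large family of
four-element sets. -/
theorem binomialRandom_real_forall_not_isClique_le {p : unitInterval} {q : ℝ} (hq : 0 < q)
    (hq1 : q < 1) (hqp : q ≤ p)
    (hD : 6 * (Fintype.card V : ℝ) ^ 2 * q ^ 5 + 4 * (Fintype.card V : ℝ) * q ^ 3 ≤ 1 / 2)
    (F : Finset (Finset V)) (hF : ∀ Q ∈ F, #Q = 4) :
    (SimpleGraph.binomialRandom V p).real {R | ∀ Q ∈ F, ¬ R.IsClique (Q : Set V)} ≤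
      (1 - q ^ 6 / 2) ^ #F := by
  classical
  rw [binomialRandom_real_eq p (P' := fun S => ∀ Q ∈ F, ¬ pairsIn Q ⊆ S) fun S => by
    simp only [isClique_pairGraph_iff]]
  have hJ := subsetExp_forall_not_subset_le hq.le hq1.le F pairsIn (m := 6)
    (fun Q hQ => by rw [card_pairsIn, hF Q hQ]; rfl)
    (fun Q hQ => (sum_pow_card_pairsIn_sdiff_le hq.le F hF (hF Q hQ)).trans hD)
  have hA := antitone_ite_forall_not_subset F (pairsIn (V := V)) ∅
  simp only [union_empty] at hA
  -- The correlation bound is assumed only at density `q`; containing some clique is increasing,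
  -- which transfers the estimate to `p`.
  have hM := subsetExp_le_of_monotone hq hq1 hqp p.2.2
    (g := fun S => 1 - (if ∀ Q ∈ F, ¬ pairsIn Q ⊆ S then (1 : ℝ) else 0))
    (fun S T h => sub_le_sub_left (hA h) 1) (fun S => by split_ifs <;> norm_num)
  rw [subsetExp_sub, subsetExp_sub, subsetExp_const, subsetExp_const] at hM
  have h1 := (sub_le_sub_iff_left _).1 hM
  refine h1.trans ((le_of_eq ?_).trans hJ)
  congr 1
  funext S
  congr

end Cliques

/-! ### Ramsey's theorem and supersaturation -/

section RamseyCount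

open Finset

/-- **Ramsey's theorem** for graphs. -/
theorem exists_clique_or_indep (a b : ℕ) : ∃ N : ℕ, ∀ {V : Type} [DecidableEq V] (G : SimpleGraph V)
    (W : Finset V), N ≤ #W → (∃ Q ⊆ W, #Q = a ∧ G.IsClique (Q : Set V)) ∨
      (∃ Q ⊆ W, #Q = b ∧ G.IsIndepSet (Q : Set V)) := by
  classical
  induction a generalizing b with
  | zero => exact ⟨0, fun G W _ => Or.inl ⟨∅, empty_subset _, rfl, by simp⟩⟩
  | succ a iha =>
    induction b with
    | zero => exact ⟨0, fun G W _ => Or.inr ⟨∅, empty_subset _, rfl, by simp⟩⟩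
    | succ b ihb =>
      obtain ⟨N₁, h₁⟩ := iha (b + 1)
      obtain ⟨N₂, h₂⟩ := ihb
      refine ⟨N₁ + N₂ + 1, fun {V} _ G W hW => ?_⟩
      obtain ⟨v, hv⟩ : W.Nonempty := card_pos.1 (by omega)
      have hc := Finset.card_filter_add_card_filter_not (s := W.erase v) (fun w => G.Adj v w)
      rw [card_erase_of_mem hv] at hc
      rcases (by omega : N₁ ≤ #((W.erase v).filter fun w => G.Adj v w) ∨
          N₂ ≤ #((W.erase v).filter fun w => ¬ G.Adj v w)) with h | h
      · rcases h₁ G _ h with ⟨Q, hQ, hQa, hQc⟩ | ⟨Q, hQ, hQb, hQi⟩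
        · have hvQ : v ∉ Q := fun h' => notMem_erase v W (mem_filter.1 (hQ h')).1
          refine Or.inl ⟨insert v Q, ?_, by rw [card_insert_of_notMem hvQ, hQa], ?_⟩
          · exact insert_subset hv fun x hx => mem_of_mem_erase (mem_filter.1 (hQ hx)).1
          · rw [coe_insert, SimpleGraph.isClique_insert]
            exact ⟨hQc, fun x hx _ => (mem_filter.1 (hQ hx)).2⟩
        · exact Or.inr ⟨Q, fun x hx => mem_of_mem_erase (mem_filter.1 (hQ hx)).1, hQb, hQi⟩
      · rcases h₂ G _ h with ⟨Q, hQ, hQa, hQc⟩ | ⟨Q, hQ, hQb, hQi⟩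
        · exact Or.inl ⟨Q, fun x hx => mem_of_mem_erase (mem_filter.1 (hQ hx)).1, hQa, hQc⟩
        · have hvQ : v ∉ Q := fun h' => notMem_erase v W (mem_filter.1 (hQ h')).1
          refine Or.inr ⟨insert v Q, ?_, by rw [card_insert_of_notMem hvQ, hQb], ?_⟩
          · exact insert_subset hv fun x hx => mem_of_mem_erase (mem_filter.1 (hQ hx)).1
          · rw [coe_insert, SimpleGraph.IsIndepSet, Set.pairwise_insert]
            refine ⟨hQi, fun x hx _ => ?_⟩
            have := (mem_filter.1 (hQ hx)).2
            exact ⟨this, fun h' => this h'.symm⟩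

/-- Supersaturation: if every `N`-element subset of `W` contains a member of a family of
four-element sets, the family is large. -/
lemma choose_four_le_card_mul {V : Type*} [DecidableEq V] {N : ℕ} (hN : 4 ≤ N) (W : Finset V)
    (hW : N ≤ #W) (F : Finset (Finset V)) (hF : ∀ Q ∈ F, Q ⊆ W ∧ #Q = 4)
    (h : ∀ X ⊆ W, #X = N → ∃ Q ∈ F, Q ⊆ X) : (#W).choose 4 ≤ #F * N.choose 4 := by
  -- Double counting: a quadruple lies in `(#W - 4).choose (N - 4)` of the `N`-sets.
  have h1 : (#W).choose N ≤ #F * (#W - 4).choose (N - 4) := by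
    rw [← card_powersetCard]
    calc #(powersetCard N W)
        ≤ #(F.biUnion fun Q => (powersetCard N W).filter fun X => Q ⊆ X) := by
          refine card_le_card fun X hX => ?_
          obtain ⟨hX1, hX2⟩ := mem_powersetCard.1 hX
          obtain ⟨Q, hQ, hQX⟩ := h X hX1 hX2
          exact mem_biUnion.2 ⟨Q, hQ, mem_filter.2 ⟨hX, hQX⟩⟩
      _ ≤ #F * (#W - 4).choose (N - 4) := by
          refine card_biUnion_le_card_mul _ _ _ fun Q hQ => ?_
          obtain ⟨hQW, hQ4⟩ := hF Q hQ
          rw [← hQ4, ← card_sdiff_of_subset hQW, ← card_powersetCard]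
          refine card_le_card_of_injOn (fun X => X \ Q) ?_ ?_
          · intro X hX
            obtain ⟨hX, hQX⟩ := mem_filter.1 hX
            obtain ⟨hX1, hX2⟩ := mem_powersetCard.1 hX
            simp only [mem_coe, mem_powersetCard]
            exact ⟨sdiff_subset_sdiff hX1 le_rfl, by rw [card_sdiff_of_subset hQX, hX2]⟩
          · intro X hX Y hY hXY
            have hX' := (mem_filter.1 hX).2
            have hY' := (mem_filter.1 hY).2
            rw [← sdiff_union_of_subset hX', ← sdiff_union_of_subset hY']
            exact congrArg (· ∪ Q) hXY
  have h2 := Nat.choose_mul (n := #W) hN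
  have h3 : 0 < (#W - 4).choose (N - 4) := Nat.choose_pos (by omega)
  refine Nat.le_of_mul_le_mul_right ?_ h3
  rw [← h2]
  calc _ ≤ #F * (#W - 4).choose (N - 4) * N.choose 4 := Nat.mul_le_mul_right _ h1
    _ = _ := by ring

end RamseyCount

/-! ### Sampling and families of dense sets -/

section Sampling

open Finset

/-- A random sample from `A` of size `t` avoids over-representing any of fewer than `2 ^ t` sparse
sets. -/
lemma exists_sample {V κ : Type*} [DecidableEq V] {A : Finset V} (hA : A.Nonempty)
    (s : Finset κ) (D : κ → Finset V) (m t : ℕ)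
    (hD : ∀ k ∈ s, #(A ∩ D k) * 4 ^ m ≤ #A) (hs : #s < 2 ^ t) :
    ∃ S : Fin t → V, (∀ i, S i ∈ A) ∧ ∀ k ∈ s, m * #{i | S i ∈ D k} < t := by
  by_contra hcon
  push Not at hcon
  set P := Fintype.piFinset (fun _ : Fin t => A)
  -- An exponential moment argument: a bad sample has total weight at least `4 ^ t`, whereas for
  -- each `k` the sum over samples factorises into at most `(2 * #A) ^ t`.
  have h1 : #A ^ t * 4 ^ t ≤ ∑ S ∈ P, ∑ k ∈ s, (4 ^ m) ^ #{i | S i ∈ D k} := by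
    have hP : #P = #A ^ t := by simp [P]
    rw [← hP, ← smul_eq_mul]
    refine Finset.card_nsmul_le_sum _ _ _ fun S hS => ?_
    obtain ⟨k, hk, hkt⟩ := hcon S (fun i => Fintype.mem_piFinset.1 hS i)
    refine le_trans ?_ (Finset.single_le_sum (fun _ _ => Nat.zero_le _) hk)
    rw [← pow_mul]
    exact Nat.pow_le_pow_right (by norm_num) hkt
  have h2 : ∑ S ∈ P, ∑ k ∈ s, (4 ^ m) ^ #{i | S i ∈ D k} ≤ #s * (2 * #A) ^ t := by
    rw [Finset.sum_comm, ← smul_eq_mul]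
    refine Finset.sum_le_card_nsmul _ _ _ fun k hk => ?_
    have h3 : ∀ S : Fin t → V, (4 ^ m) ^ #{i | S i ∈ D k} =
        ∏ i, if S i ∈ D k then 4 ^ m else 1 := by
      intro S
      rw [Finset.prod_ite, Finset.prod_const, Finset.prod_const_one, mul_one]
    simp only [h3]
    rw [← Finset.sum_pow' A (fun a => if a ∈ D k then 4 ^ m else 1) t]
    refine Nat.pow_le_pow_left ?_ t
    rw [Finset.sum_ite, Finset.sum_const, Finset.sum_const, smul_eq_mul, smul_eq_mul, mul_one,
      Finset.filter_mem_eq_inter, two_mul]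
    exact add_le_add (hD k hk) (card_filter_le _ _)
  have hA' : 0 < #A ^ t := pow_pos (card_pos.2 hA) t
  have h4 : #s * (2 * #A) ^ t < #A ^ t * 4 ^ t := by
    have : (4 : ℕ) ^ t = 2 ^ t * 2 ^ t := by rw [← mul_pow]; norm_num
    rw [mul_pow, this]
    calc #s * (2 ^ t * #A ^ t) < 2 ^ t * (2 ^ t * #A ^ t) :=
          Nat.mul_lt_mul_of_pos_right hs (by positivity)
      _ = _ := by ring
  omega

/-- Many dense subsets of `Fin t` cannot have pairwise small intersections. -/
lemma not_forall_card_inter_lt {V : Type*} [DecidableEq V] {t : ℕ} (ht : 0 < t) {ρ : ℝ} (hρ : 0 < ρ)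
    (x : V → Finset (Fin t)) (Q : Finset V) (hQ : 2 / ρ ^ 2 < #Q) (h1 : ∀ b ∈ Q, ρ * t ≤ #(x b))
    (h2 : ∀ b ∈ Q, ∀ b' ∈ Q, b ≠ b' → (#(x b ∩ x b') : ℝ) < ρ ^ 2 / 2 * t) : False := by
  -- The number of sets containing `i`. Its first moment is large by density and its second moment
  -- small by the intersections, contradicting Cauchy–Schwarz.
  set f : Fin t → ℝ := fun i => ∑ b ∈ Q, if i ∈ x b then 1 else 0 with hf
  have ht' : (0 : ℝ) < t := by exact_mod_cast ht
  have hsum : ∑ i, f i = ∑ b ∈ Q, (#(x b) : ℝ) := by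
    rw [hf, Finset.sum_comm]
    refine Finset.sum_congr rfl fun b _ => ?_
    simp
  have hsq : ∑ i, f i ^ 2 = ∑ b ∈ Q, ∑ b' ∈ Q, (#(x b ∩ x b') : ℝ) := by
    simp only [hf, sq, Finset.sum_mul_sum]
    rw [Finset.sum_comm]
    refine Finset.sum_congr rfl fun b _ => ?_
    rw [Finset.sum_comm]
    refine Finset.sum_congr rfl fun b' _ => ?_
    simp only [← ite_and, ite_mul, one_mul, zero_mul]
    rw [Finset.sum_boole]
    congr 2
    ext i; simp
  have hlow : (#Q : ℝ) * (ρ * t) ≤ ∑ i, f i := by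
    rw [hsum, ← nsmul_eq_mul]
    exact Finset.card_nsmul_le_sum _ _ _ h1
  have hcs : (∑ i, f i) ^ 2 ≤ t * ∑ i, f i ^ 2 := by
    have := sq_sum_le_card_mul_sum_sq (s := (univ : Finset (Fin t))) (f := f)
    simpa using this
  have hup : ∑ i, f i ^ 2 ≤ #Q * (t + #Q * (ρ ^ 2 / 2 * t)) := by
    rw [hsq, ← nsmul_eq_mul]
    refine Finset.sum_le_card_nsmul _ _ _ fun b hb => ?_
    rw [← Finset.add_sum_erase _ _ hb]
    refine add_le_add ?_ ?_
    · have := card_le_univ (x b ∩ x b)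
      rw [Fintype.card_fin] at this
      exact_mod_cast this
    · calc ∑ b' ∈ Q.erase b, (#(x b ∩ x b') : ℝ) ≤ #(Q.erase b) • (ρ ^ 2 / 2 * t) := by
            refine Finset.sum_le_card_nsmul _ _ _ fun b' hb' => ?_
            exact (h2 b hb b' (mem_of_mem_erase hb') (ne_of_mem_erase hb').symm).le
        _ ≤ _ := by
            rw [nsmul_eq_mul]
            refine mul_le_mul_of_nonneg_right ?_ (by positivity)
            exact_mod_cast card_le_card (erase_subset _ _)
  have hk : (0 : ℝ) < #Q := lt_trans (by positivity) hQ
  have h5 : ((#Q : ℝ) * (ρ * t)) ^ 2 ≤ t * (#Q * (t + #Q * (ρ ^ 2 / 2 * t))) :=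
    (pow_le_pow_left₀ (by positivity) hlow 2).trans
      (hcs.trans (mul_le_mul_of_nonneg_left hup ht'.le))
  have h6 : (#Q * t ^ 2 : ℝ) * (#Q * ρ ^ 2) ≤ (#Q * t ^ 2 : ℝ) * (1 + #Q * ρ ^ 2 / 2) := by
    nlinarith
  have h7 := le_of_mul_le_mul_left h6 (by positivity)
  rw [div_lt_iff₀ (by positivity)] at hQ
  linarith

end Sampling

/-! ### Richness of the random graph -/

section Rich

open Finset MeasureTheory

/-- Whenever many vertices are assigned dense subsets of `Fin t`, some four-clique of `R` has
all its vertices assigned dense subsets with pairwise large intersections. -/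
def Rich {V : Type*} [Fintype V] [DecidableEq V] (t : ℕ) (ρ δ : ℝ) (R : SimpleGraph V) : Prop :=
  ∀ x : V → Finset (Fin t), δ * Fintype.card V ≤ #{b | ρ * t ≤ #(x b)} →
    ∃ Q : Finset V, #Q = 4 ∧ R.IsClique (Q : Set V) ∧ (∀ b ∈ Q, ρ * t ≤ #(x b)) ∧
      ∀ b ∈ Q, ∀ b' ∈ Q, b ≠ b' → ρ ^ 2 / 2 * t ≤ #(x b ∩ x b')

/-- Here 384 = 24 · 16, since w - 3 ≥ w / 2. -/
lemma pow_four_le_choose {w : ℕ} (hw : 6 ≤ w) : (w : ℝ) ^ 4 ≤ 384 * (w.choose 4 : ℝ) := by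
  have h := Nat.pow_le_choose 4 w (α := ℝ)
  have h1 : ((w + 1 - 4 : ℕ) : ℝ) = w - 3 := by
    rw [Nat.cast_sub (by omega)]; push_cast; ring
  have h24 : ((Nat.factorial 4 : ℕ) : ℝ) = 24 := by norm_num [Nat.factorial]
  rw [h1] at h
  have hw' : (6 : ℝ) ≤ w := by exact_mod_cast hw
  have h2 : ((w : ℝ) / 2) ^ 4 ≤ (w - 3 : ℝ) ^ 4 :=
    pow_le_pow_left₀ (by positivity) (by linarith) 4
  have h3 : ((w : ℝ) / 2) ^ 4 = w ^ 4 / 16 := by ring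
  rw [div_le_iff₀ (by positivity)] at h
  rw [h24] at h
  linarith

/-- For a fixed assignment, join two vertices when their sets intersect substantially. More than 2 /
ρ² vertices with dense sets are never independent, so by Ramsey any `N` of them contain a suitable
quadruple; supersaturation yields order n⁴ quadruples, and Janson bounds the chance of missing them
all. The factor `2 ^ (t * n)` counts assignments. -/
theorem exists_binomialRandom_real_not_rich_le {ρ δ : ℝ} (hρ : 0 < ρ) (hδ : 0 < δ) :
    ∃ c : ℝ, 0 < c ∧ ∃ N : ℕ, ∀ (n t : ℕ) (p : unitInterval) (q : ℝ), (N : ℝ) ≤ δ * n → 0 < t →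
      0 < q → q < 1 → q ≤ p → 6 * (n : ℝ) ^ 2 * q ^ 5 + 4 * (n : ℝ) * q ^ 3 ≤ 1 / 2 →
      (SimpleGraph.binomialRandom (Fin n) p).real {R | ¬ Rich t ρ δ R} ≤
        2 ^ (t * n) * Real.exp (-(c * (n : ℝ) ^ 4 * q ^ 6)) := by
  classical
  obtain ⟨N₀, hN₀⟩ := exists_clique_or_indep 4 (⌊2 / ρ ^ 2⌋₊ + 1)
  set N := max N₀ 6 with hN
  have hN6 : 6 ≤ N := le_max_right _ _
  have hchoose : (0 : ℝ) < N.choose 4 := by exact_mod_cast Nat.choose_pos (by omega)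
  refine ⟨δ ^ 4 / (768 * N.choose 4), by positivity, N, fun n t p q hn ht hq0 hq1 hqp hD => ?_⟩
  set W : (Fin n → Finset (Fin t)) → Finset (Fin n) :=
    fun x => univ.filter fun b => ρ * t ≤ #(x b) with hWdef
  set s : Finset (Fin n → Finset (Fin t)) := univ.filter fun x => δ * n ≤ #(W x) with hs
  set F : (Fin n → Finset (Fin t)) → Finset (Finset (Fin n)) := fun x =>
    (powersetCard 4 (W x)).filter fun Q =>
      ∀ b ∈ Q, ∀ b' ∈ Q, b ≠ b' → ρ ^ 2 / 2 * t ≤ #(x b ∩ x b') with hF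
  have hF4 : ∀ x, ∀ Q ∈ F x, Q ⊆ W x ∧ #Q = 4 := fun x Q hQ =>
    mem_powersetCard.1 (mem_filter.1 hQ).1
  have hincl : ({R | ¬ Rich t ρ δ R} : Set (SimpleGraph (Fin n))) ⊆
      {R | ∃ x ∈ s, ∀ Q ∈ F x, ¬ R.IsClique (Q : Set (Fin n))} := by
    intro R hR
    have hR' : ¬ Rich t ρ δ R := hR
    unfold Rich at hR'
    push Not at hR'
    obtain ⟨x, hx1, hx2⟩ := hR'
    refine ⟨x, mem_filter.2 ⟨mem_univ _, by simpa using hx1⟩, fun Q hQ hcl => ?_⟩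
    obtain ⟨hQW, hQ4⟩ := hF4 x Q hQ
    obtain ⟨b, hb, b', hb', hne, hlt⟩ := hx2 Q hQ4 hcl fun b hb => (mem_filter.1 (hQW hb)).2
    exact absurd ((mem_filter.1 hQ).2 b hb b' hb' hne) (not_le.2 hlt)
  have hbound : ∀ x ∈ s, (SimpleGraph.binomialRandom (Fin n) p).real
      {R | ∀ Q ∈ F x, ¬ R.IsClique (Q : Set (Fin n))} ≤
        Real.exp (-(δ ^ 4 / (768 * N.choose 4) * (n : ℝ) ^ 4 * q ^ 6)) := by
    intro x hx
    have hWx : δ * n ≤ #(W x) := (mem_filter.1 hx).2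
    have hNW : N ≤ #(W x) := by exact_mod_cast hn.trans hWx
    have hcount := choose_four_le_card_mul (by omega : 4 ≤ N) (W x) hNW (F x) (hF4 x)
      (by
        intro X hXW hXN
        let Γ : SimpleGraph (Fin n) := SimpleGraph.fromRel fun b b' => ρ ^ 2 / 2 * t ≤ #(x b ∩ x b')
        have hΓ : ∀ b b', b ≠ b' → (Γ.Adj b b' ↔ ρ ^ 2 / 2 * t ≤ #(x b ∩ x b')) := by
          intro b b' hbb
          simp only [Γ, SimpleGraph.fromRel_adj, Finset.inter_comm (x b') (x b), or_self]
          exact and_iff_right hbb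
        rcases hN₀ Γ X (by rw [hXN]; exact le_max_left _ _) with
          ⟨Q, hQX, hQ4, hQc⟩ | ⟨Q, hQX, hQk, hQi⟩
        · refine ⟨Q, mem_filter.2 ⟨mem_powersetCard.2 ⟨hQX.trans hXW, hQ4⟩, ?_⟩, hQX⟩
          exact fun b hb b' hb' hbb => (hΓ b b' hbb).1 (hQc hb hb' hbb)
        · exfalso
          refine not_forall_card_inter_lt ht hρ x Q ?_
            (fun b hb => (mem_filter.1 (hXW (hQX hb))).2) fun b hb b' hb' hbb => ?_
          · rw [hQk]; push_cast; exact Nat.lt_floor_add_one _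
          · exact not_le.1 fun h => hQi hb hb' hbb ((hΓ b b' hbb).2 h))
    have hcount' : ((#(W x)).choose 4 : ℝ) ≤ #(F x) * N.choose 4 := by exact_mod_cast hcount
    have hw4 := pow_four_le_choose (hN6.trans hNW)
    have hδ4 : (δ * n) ^ 4 ≤ (#(W x) : ℝ) ^ 4 := pow_le_pow_left₀ (by positivity) hWx 4
    have hFx : δ ^ 4 / (384 * N.choose 4) * (n : ℝ) ^ 4 ≤ #(F x) := by
      rw [div_mul_eq_mul_div, div_le_iff₀ (by positivity)]
      nlinarith
    have hJ := binomialRandom_real_forall_not_isClique_le hq0 hq1 hqp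
      (by rw [Fintype.card_fin]; exact hD) (F x) fun Q hQ => (hF4 x Q hQ).2
    refine hJ.trans ?_
    have hq6 : q ^ 6 ≤ 1 := pow_le_one₀ hq0.le hq1.le
    calc (1 - q ^ 6 / 2) ^ #(F x) ≤ Real.exp (-(q ^ 6 / 2)) ^ #(F x) :=
          pow_le_pow_left₀ (by linarith) (Real.one_sub_le_exp_neg _) _
      _ = Real.exp (-(#(F x) * (q ^ 6 / 2))) := by rw [← Real.exp_nat_mul]; ring_nf
      _ ≤ _ := by
          refine Real.exp_le_exp.2 (neg_le_neg ?_)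
          calc δ ^ 4 / (768 * N.choose 4) * (n : ℝ) ^ 4 * q ^ 6
              = δ ^ 4 / (384 * N.choose 4) * (n : ℝ) ^ 4 * (q ^ 6 / 2) := by
                field_simp; ring
            _ ≤ _ := mul_le_mul_of_nonneg_right hFx (by positivity)
  calc _ ≤ (SimpleGraph.binomialRandom (Fin n) p).real
        {R | ∃ x ∈ s, ∀ Q ∈ F x, ¬ R.IsClique (Q : Set (Fin n))} :=
        measureReal_mono hincl
    _ ≤ ∑ x ∈ s, (SimpleGraph.binomialRandom (Fin n) p).real
        {R | ∀ Q ∈ F x, ¬ R.IsClique (Q : Set (Fin n))} := binomialRandom_real_exists_le _ _ _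
    _ ≤ #s • Real.exp (-(δ ^ 4 / (768 * N.choose 4) * (n : ℝ) ^ 4 * q ^ 6)) :=
        Finset.sum_le_card_nsmul _ _ _ hbound
    _ ≤ _ := by
        rw [nsmul_eq_mul]
        refine mul_le_mul_of_nonneg_right ?_ (Real.exp_pos _).le
        have : #s ≤ 2 ^ (t * n) := by
          refine (card_le_univ s).trans (le_of_eq ?_)
          simp [← pow_mul]
        exact_mod_cast this

end Rich

/-! ### Rich graphs force a monochromatic K₄ -/

section DenseArrows

open Finset

variable {V : Type*} [Fintype V] [DecidableEq V]

lemma completeGraph_four_isContained {H : SimpleGraph V} {Q : Finset V} (h : H.IsClique (Q : Set V))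
    (h4 : #Q = 4) : (SimpleGraph.completeGraph (Fin 4)).IsContained H := by
  have hn : H.IsNClique 4 Q := ⟨h, h4⟩
  exact (SimpleGraph.not_cliqueFree_iff_top_isContained 4).1 hn.not_cliqueFree

lemma exists_isContained_of_adj {H : SimpleGraph V} {a b u v : V} (hab : H.Adj a b)
    (hau : H.Adj a u) (hav : H.Adj a v) (hbu : H.Adj b u) (hbv : H.Adj b v) (huv : H.Adj u v) :
    (SimpleGraph.completeGraph (Fin 4)).IsContained H := by
  refine completeGraph_four_isContained (Q := {a, b, u, v}) ?_ ?_
  · simp only [coe_insert, coe_singleton, SimpleGraph.isClique_insert, Set.mem_insert_iff,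
      Set.mem_singleton_iff]
    refine ⟨⟨⟨by simp, ?_⟩, ?_⟩, ?_⟩
    · rintro _ rfl _; exact huv
    · rintro _ (rfl | rfl) _ <;> assumption
    · rintro _ (rfl | rfl | rfl) _ <;> assumption
  · rw [card_insert_of_notMem, card_insert_of_notMem, card_insert_of_notMem, card_singleton]
    · simpa using huv.ne
    · simpa using ⟨hbu.ne, hbv.ne⟩
    · simpa using ⟨hab.ne, hau.ne, hav.ne⟩

-- The degree sum is at least 2γn², and the vertices of degree below γn contribute at most γn² to
-- it.
open Classical in
lemma exists_dense_degrees {G : SimpleGraph V} {γ : ℝ} (hγ : 0 < γ) (hG : IsDense γ G)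
    (hV : 0 < Fintype.card V) :
    γ * Fintype.card V ≤ #{v | γ * Fintype.card V ≤ G.degree v} := by
  set n : ℝ := (Fintype.card V : ℝ) with hn
  have hn0 : 0 < n := by rw [hn]; exact_mod_cast hV
  set A : Finset V := {v | γ * n ≤ G.degree v} with hA
  have hsum : (∑ v, (G.degree v : ℝ)) = 2 * (G.edgeSet.ncard : ℝ) := by
    have h := G.sum_degrees_eq_twice_card_edges
    rw [← SimpleGraph.coe_edgeFinset, Set.ncard_coe_finset]
    exact_mod_cast h
  have hup : ∑ v, (G.degree v : ℝ) ≤ ∑ v, ((if v ∈ A then n else 0) + γ * n) := by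
    refine Finset.sum_le_sum fun v _ => ?_
    have hd : (G.degree v : ℝ) ≤ n := by
      rw [hn]; exact_mod_cast (G.degree_lt_card_verts v).le
    by_cases hv : v ∈ A
    · have hv' := (mem_filter.1 hv).2
      rw [if_pos hv]
      nlinarith
    · have hv' : ¬ γ * n ≤ G.degree v := fun h => hv (mem_filter.2 ⟨mem_univ _, h⟩)
      rw [if_neg hv]; linarith
  rw [Finset.sum_add_distrib, Finset.sum_ite_mem, Finset.sum_const, Finset.sum_const, univ_inter,
    nsmul_eq_mul, nsmul_eq_mul, card_univ, ← hn, hsum] at hup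
  unfold IsDense at hG
  rw [Nat.card_eq_fintype_card, ← hn] at hG
  nlinarith

open Classical in
/-- If the random graph is rich, then its union with a dense graph has the Ramsey property. -/
theorem arrows_of_rich {G R : SimpleGraph V} {γ : ℝ} (hγ : 0 < γ) (hγ1 : γ ≤ 1) (hG : IsDense γ G)
    (hV : 0 < Fintype.card V) {m t : ℕ} (hm : 1 ≤ (γ / 4) ^ 2 / 2 * m)
    (ht : 2 * Fintype.card V ^ 2 < 2 ^ t) (hR : Rich t (γ / 4) (γ / 4 ^ m) R) :
    Arrows (G ⊔ R) (SimpleGraph.completeGraph (Fin 4)) := by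
  intro C
  set n : ℝ := (Fintype.card V : ℝ) with hn
  have hn0 : 0 < n := by rw [hn]; exact_mod_cast hV
  have ht0 : 0 < t := by
    rcases Nat.eq_zero_or_pos t with h | h
    · subst h
      have : 0 < Fintype.card V ^ 2 := by positivity
      omega
    · exact h
  have htR : (0 : ℝ) < t := by exact_mod_cast ht0
  have hm1 : 1 ≤ m := by
    rcases Nat.eq_zero_or_pos m with h | h
    · subst h; norm_num at hm
    · exact h
  have h4m : (4 : ℝ) ≤ 4 ^ m := by
    calc (4 : ℝ) = 4 ^ 1 := by norm_num
      _ ≤ 4 ^ m := pow_le_pow_right₀ (by norm_num) hm1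
  set A : Finset V := {v | γ * n ≤ G.degree v} with hA
  have hAcard : γ * n ≤ #A := exists_dense_degrees hγ hG hV
  have hAne : A.Nonempty := by
    rw [← card_pos]
    have : (0 : ℝ) < #A := lt_of_lt_of_le (by positivity) hAcard
    exact_mod_cast this
  set D : Fin 2 → V → Finset V :=
    fun c b => univ.filter fun a => G.Adj b a ∧ (C.labelGraph c).Adj b a with hDdef
  -- The colours and pairs whose common neighbourhood is sparse in `A`. There are at most 2n² < 2^t
  -- of them, so one sample avoids over-representing all.
  set s : Finset (Fin 2 × V × V) :=
    univ.filter fun k => #(A ∩ (D k.1 k.2.1 ∩ D k.1 k.2.2)) * 4 ^ m ≤ #A with hs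
  have hscard : #s < 2 ^ t := by
    refine lt_of_le_of_lt (card_le_univ s) (lt_of_eq_of_lt ?_ ht)
    simp [sq]
  obtain ⟨S, hSA, hS⟩ := exists_sample hAne s (fun k => D k.1 k.2.1 ∩ D k.1 k.2.2) m t
    (fun k hk => (mem_filter.1 hk).2) hscard
  set x : Fin 2 → V → Finset (Fin t) := fun c b => univ.filter fun i => S i ∈ D c b with hx
  set W : Fin 2 → Finset V := fun c => univ.filter fun b => γ / 4 * t ≤ #(x c b) with hW
  -- some colour has many vertices with dense samples
  have hWlarge : ∃ c, γ / 4 ^ m * n ≤ #(W c) := by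
    by_contra hcon
    push Not at hcon
    have hdeg : ∑ b, #{i | G.Adj b (S i)} = ∑ i, G.degree (S i) := by
      simp only [card_filter]
      rw [Finset.sum_comm]
      refine Finset.sum_congr rfl fun i _ => ?_
      rw [← card_filter, ← SimpleGraph.card_neighborFinset_eq_degree]
      congr 1
      ext b; simp [SimpleGraph.adj_comm]
    have hlow : t * (γ * n) ≤ ∑ b, (#{i | G.Adj b (S i)} : ℝ) := by
      have h1 : (t : ℝ) * (γ * n) ≤ ∑ i, (G.degree (S i) : ℝ) := by
        have := Finset.card_nsmul_le_sum (univ : Finset (Fin t)) (fun i => (G.degree (S i) : ℝ))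
          (γ * n) fun i _ => (mem_filter.1 (hSA i)).2
        simpa using this
      exact_mod_cast h1.trans (by exact_mod_cast hdeg.symm.le)
    -- A vertex outside both `W 0` and `W 1` sees fewer than γt/4 samples in each colour. If both
    -- sets had fewer than γn/4 elements, the total would stay below γtn.
    have hup : ∑ b, (#{i | G.Adj b (S i)} : ℝ) ≤
        ∑ b, ((if b ∈ W 0 then (t : ℝ) else 0) + (if b ∈ W 1 then (t : ℝ) else 0) + γ / 2 * t) := by
      refine Finset.sum_le_sum fun b _ => ?_
      have htriv : (#{i | G.Adj b (S i)} : ℝ) ≤ t := by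
        have := card_le_univ ({i | G.Adj b (S i)} : Finset (Fin t))
        rw [Fintype.card_fin] at this
        exact_mod_cast this
      have hpos : 0 ≤ γ / 2 * t := by positivity
      by_cases h0 : b ∈ W 0
      · rw [if_pos h0]
        have : (0 : ℝ) ≤ if b ∈ W 1 then (t : ℝ) else 0 := by split_ifs <;> positivity
        linarith
      by_cases h1 : b ∈ W 1
      · rw [if_pos h1, if_neg h0]; linarith
      rw [if_neg h0, if_neg h1]
      have h0' : (#(x 0 b) : ℝ) < γ / 4 * t := by
        by_contra h; exact h0 (mem_filter.2 ⟨mem_univ _, not_lt.1 h⟩)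
      have h1' : (#(x 1 b) : ℝ) < γ / 4 * t := by
        by_contra h; exact h1 (mem_filter.2 ⟨mem_univ _, not_lt.1 h⟩)
      have hle : #{i | G.Adj b (S i)} ≤ #(x 0 b) + #(x 1 b) := by
        refine (card_le_card ?_).trans (card_union_le _ _)
        intro i hi
        have hadj := (mem_filter.1 hi).2
        have hadj' : (G ⊔ R).Adj b (S i) := Or.inl hadj
        simp only [hx, hDdef, mem_union, mem_filter, mem_univ, true_and, hadj,
          SimpleGraph.EdgeLabeling.labelGraph_adj]
        have h2 : ∀ c : Fin 2, c = 0 ∨ c = 1 := by decide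
        rcases h2 (C ⟨s(b, S i), hadj'⟩) with h | h
        · exact Or.inl ⟨hadj', h⟩
        · exact Or.inr ⟨hadj', h⟩
      have hle' : (#{i | G.Adj b (S i)} : ℝ) ≤ #(x 0 b) + #(x 1 b) := by exact_mod_cast hle
      linarith
    rw [Finset.sum_add_distrib, Finset.sum_add_distrib, Finset.sum_ite_mem, Finset.sum_ite_mem,
      univ_inter, univ_inter, Finset.sum_const, Finset.sum_const, Finset.sum_const, card_univ,
      nsmul_eq_mul, nsmul_eq_mul, nsmul_eq_mul, ← hn] at hup
    have h0 := hcon 0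
    have h1 := hcon 1
    have hsmall : γ / 4 ^ m * n ≤ γ / 4 * n := by gcongr
    nlinarith
  obtain ⟨c, hc⟩ := hWlarge
  obtain ⟨d, hd⟩ : ∃ d : Fin 2, ∀ e : Fin 2, e = c ∨ e = d := by
    have h2 : ∀ c : Fin 2, ∃ d : Fin 2, ∀ e : Fin 2, e = c ∨ e = d := by decide
    exact h2 c
  have hcol : ∀ u v, (G ⊔ R).Adj u v → ¬ (C.labelGraph d).Adj u v → (C.labelGraph c).Adj u v := by
    intro u v huv h
    rw [SimpleGraph.EdgeLabeling.labelGraph_adj] at h ⊢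
    refine ⟨huv, (hd _).resolve_right fun h' => h ⟨huv, h'⟩⟩
  obtain ⟨Q, hQ4, hQR, hQρ, hQτ⟩ := hR (x c) hc
  by_cases hQd : (C.labelGraph d).IsClique (Q : Set V)
  · exact ⟨d, completeGraph_four_isContained hQd hQ4⟩
  obtain ⟨b, hb, b', hb', hbb, hnd⟩ : ∃ b ∈ Q, ∃ b' ∈ Q, b ≠ b' ∧ ¬ (C.labelGraph d).Adj b b' := by
    by_contra hcon
    push Not at hcon
    exact hQd fun b hb b' hb' h => hcon b hb b' hb' h
  have hbc : (C.labelGraph c).Adj b b' := hcol b b' (Or.inr (hQR hb hb' hbb)) hnd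
  set A' : Finset V := D c b ∩ D c b' with hA'
  have hA'card : γ / 4 ^ m * n ≤ #A' := by
    have h1 := hQτ b hb b' hb' hbb
    have h2 : t ≤ m * #{i | S i ∈ A'} := by
      have h3 : x c b ∩ x c b' = ({i | S i ∈ A'} : Finset (Fin t)) := by
        ext i; simp [hx, hA']
      rw [h3] at h1
      have : (t : ℝ) ≤ m * #{i | S i ∈ A'} := by
        calc (t : ℝ) ≤ ((γ / 4) ^ 2 / 2 * m) * t := le_mul_of_one_le_left htR.le hm
          _ = m * ((γ / 4) ^ 2 / 2 * t) := by ring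
          _ ≤ _ := by gcongr
      exact_mod_cast this
    -- At least t/m samples hit `A'`, which by the choice of the sample is impossible for sparse
    -- triples.
    have h4 : (c, b, b') ∉ s := fun h => absurd (hS _ h) (not_lt.2 h2)
    have h5 : #A < #(A ∩ A') * 4 ^ m := by
      by_contra h; exact h4 (mem_filter.2 ⟨mem_univ _, not_lt.1 h⟩)
    have h6 : #(A ∩ A') ≤ #A' := card_le_card inter_subset_right
    have h7 : (#A : ℝ) ≤ #A' * 4 ^ m := by
      exact_mod_cast h5.le.trans (Nat.mul_le_mul_right _ h6)
    rw [div_mul_eq_mul_div, div_le_iff₀ (by positivity)]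
    linarith
  -- Full sets on `A'` and empty sets elsewhere turn richness into the existence of a four-clique of
  -- `R` inside `A'`.
  obtain ⟨Q', hQ'4, hQ'R, hQ'ρ, -⟩ := hR (fun a => if a ∈ A' then univ else ∅) (by
    refine hA'card.trans ?_
    refine Nat.cast_le.2 (card_le_card fun a ha => ?_)
    simp only [mem_filter, mem_univ, true_and, ha, if_true, card_univ, Fintype.card_fin]
    nlinarith)
  have hQ'A : ∀ a ∈ Q', a ∈ A' := by
    intro a ha
    by_contra hna
    have := hQ'ρ a ha
    simp only [hna, if_false, card_empty, Nat.cast_zero] at this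
    have : 0 < γ / 4 * t := by positivity
    linarith
  by_cases hQ'd : (C.labelGraph d).IsClique (Q' : Set V)
  · exact ⟨d, completeGraph_four_isContained hQ'd hQ'4⟩
  obtain ⟨u, hu, v, hv, huv, hnd'⟩ : ∃ u ∈ Q', ∃ v ∈ Q', u ≠ v ∧ ¬ (C.labelGraph d).Adj u v := by
    by_contra hcon
    push Not at hcon
    exact hQ'd fun b hb b' hb' h => hcon b hb b' hb' h
  have huc : (C.labelGraph c).Adj u v := hcol u v (Or.inr (hQ'R hu hv huv)) hnd'
  have hmem : ∀ a ∈ Q', (C.labelGraph c).Adj b a ∧ (C.labelGraph c).Adj b' a := by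
    intro a ha
    have := hQ'A a ha
    simp only [hA', hDdef, mem_inter, mem_filter, mem_univ, true_and] at this
    exact ⟨this.1.2, this.2.2⟩
  exact ⟨c, exists_isContained_of_adj hbc (hmem u hu).1 (hmem v hv).1 (hmem u hu).2 (hmem v hv).2 huc⟩

end DenseArrows

/-! ### Asymptotics for part (i) -/

section DenseAsymptotics

lemma natCast_rpow_pow {n : ℕ} (a b : ℝ) (j k : ℕ) (hn : 0 < n) (h : j + k * a = b) :
    (n : ℝ) ^ j * ((n : ℝ) ^ a) ^ k = (n : ℝ) ^ b := by
  have hn' : (0 : ℝ) < n := by exact_mod_cast hn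
  rw [← Real.rpow_natCast _ j, ← Real.rpow_natCast _ k, ← Real.rpow_mul hn'.le,
    ← Real.rpow_add hn', ← h]
  ring_nf

lemma two_mul_sq_lt_two_pow (n : ℕ) : 2 * n ^ 2 < 2 ^ (2 * (Nat.log 2 n + 1) + 1) := by
  have h := Nat.lt_pow_succ_log_self (b := 2) (by norm_num) n
  rw [pow_succ 2 (2 * _), pow_mul', mul_comm]
  exact Nat.mul_lt_mul_of_pos_right (Nat.pow_lt_pow_left h (by norm_num)) (by norm_num)

lemma natLog_le_real_log (n : ℕ) (hn : n ≠ 0) : (Nat.log 2 n : ℝ) ≤ 2 * Real.log n := by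
  have h := Nat.pow_log_le_self 2 hn
  have h1 : ((2 : ℝ) ^ Nat.log 2 n) ≤ n := by exact_mod_cast h
  have h2 := Real.log_le_log (by positivity) h1
  rw [Real.log_pow] at h2
  have h3 := Real.log_two_gt_d9
  have h4 : (0 : ℝ) ≤ Nat.log 2 n := Nat.cast_nonneg _
  nlinarith

theorem aas_arrows_of_isDense {γ ε : ℝ} (hγ : 0 < γ) (hε : 0 < ε)
    (G : (n : ℕ) → SimpleGraph (Fin n)) (hG : ∀ᶠ n in atTop, IsDense γ (G n))
    (p : ℕ → unitInterval)
    (hp : ∀ᶠ n : ℕ in atTop, (n : ℝ) ^ (-(1 / 2 : ℝ) + ε) ≤ (p n : ℝ)) :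
    AAS p (fun n R => Arrows (G n ⊔ R) (SimpleGraph.completeGraph (Fin 4))) := by
  set γ' := min γ 1
  -- With η ≤ 1/20 the correlation terms n²q⁵ and nq³ are at most n^(-1/4).
  set η := min ε (1 / 20)
  have hγ' : 0 < γ' := lt_min hγ one_pos
  have hη : 0 < η := lt_min hε (by norm_num)
  have hη1 : η ≤ 1 / 20 := min_le_right _ _
  -- This `m` turns intersections of size (ρ²/2)t, with ρ = γ'/4, into at least t/m samples.
  obtain ⟨m, hm⟩ := exists_nat_ge (1 / ((γ' / 4) ^ 2 / 2))
  rw [div_le_iff₀' (by positivity)] at hm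
  obtain ⟨c, hc, N, hN⟩ := exists_binomialRandom_real_not_rich_le
    (ρ := γ' / 4) (δ := γ' / 4 ^ m) (by positivity) (by positivity)
  set t : ℕ → ℕ := fun n => 2 * (Nat.log 2 n + 1) + 1
  set q : ℕ → ℝ := fun n => (n : ℝ) ^ (-(1 / 2 : ℝ) + η) with hq
  have hcast := tendsto_natCast_atTop_atTop (R := ℝ)
  -- the exponent is eventually at most `-n`
  have hexp : ∀ᶠ n : ℕ in atTop, (t n : ℝ) * n - c * (n : ℝ) ^ 4 * q n ^ 6 ≤ -n := by
    have h1 := (isLittleO_log_rpow_atTop (r := 6 * η) (by positivity)).def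
      (c := c / 8) (by positivity)
    have h2 := tendsto_rpow_atTop (y := 6 * η) (by positivity)
    filter_upwards [hcast.eventually h1, (h2.comp hcast).eventually_ge_atTop (8 / c),
      eventually_ge_atTop 1] with n h1 h2 hn
    have hn' : (1 : ℝ) ≤ n := by exact_mod_cast hn
    rw [Real.norm_of_nonneg (Real.log_nonneg hn'), Real.norm_of_nonneg (by positivity)] at h1
    have h3 : (n : ℝ) ^ 4 * q n ^ 6 = n * (n : ℝ) ^ (6 * η) := by
      rw [hq, natCast_rpow_pow _ (1 + 6 * η) 4 6 (by omega) (by push_cast; ring),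
        Real.rpow_add (by linarith), Real.rpow_one]
    have h4 := natLog_le_real_log n (by omega)
    have h5 : (t n : ℝ) = 2 * (Nat.log 2 n + 1) + 1 := by simp [t]
    have h2' : 8 ≤ c * (n : ℝ) ^ (6 * η) := by
      rw [div_le_iff₀' hc] at h2; exact h2
    have h6 : (t n : ℝ) + 1 ≤ c * (n : ℝ) ^ (6 * η) := by rw [h5]; linarith
    rw [mul_assoc c, h3]
    nlinarith
  have hD : ∀ᶠ n : ℕ in atTop, 6 * (n : ℝ) ^ 2 * q n ^ 5 + 4 * (n : ℝ) * q n ^ 3 ≤ 1 / 2 := by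
    have h1 := (tendsto_rpow_neg_atTop (y := 1 / 4) (by norm_num)).comp hcast
    filter_upwards [h1.eventually_le_const (show (0 : ℝ) < 1 / 20 by norm_num),
      eventually_ge_atTop 1] with n h1 hn
    have hn' : (1 : ℝ) ≤ n := by exact_mod_cast hn
    have h1' : (n : ℝ) ^ (-(1 / 4) : ℝ) ≤ 1 / 20 := h1
    have h2 : (n : ℝ) ^ 2 * q n ^ 5 ≤ (n : ℝ) ^ (-(1 / 4) : ℝ) := by
      rw [hq, natCast_rpow_pow _ (-(1 / 2) + 5 * η) 2 5 (by omega) (by push_cast; ring)]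
      exact Real.rpow_le_rpow_of_exponent_le hn' (by linarith)
    have h3 : (n : ℝ) ^ 1 * q n ^ 3 ≤ (n : ℝ) ^ (-(1 / 4) : ℝ) := by
      rw [hq, natCast_rpow_pow _ (-(1 / 2) + 3 * η) 1 3 (by omega) (by push_cast; ring)]
      exact Real.rpow_le_rpow_of_exponent_le hn' (by linarith)
    rw [pow_one] at h3
    linarith
  have hNn : ∀ᶠ n : ℕ in atTop, (N : ℝ) ≤ γ' / 4 ^ m * n :=
    (hcast.const_mul_atTop (by positivity)).eventually_ge_atTop _
  refine aas_of_tendsto (fun n => Real.exp (-(n : ℝ)))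
    (Real.tendsto_exp_neg_atTop_nhds_zero.comp hcast) ?_
  filter_upwards [hexp, hD, hNn, hG, hp, eventually_ge_atTop 2] with n hexp hD hNn hG hp hn
  have hn' : (2 : ℝ) ≤ n := by exact_mod_cast hn
  have hGn : IsDense γ' (G n) := by
    refine le_trans ?_ hG
    exact mul_le_mul_of_nonneg_right (min_le_left _ _) (by positivity)
  have hqp : q n ≤ p n :=
    (Real.rpow_le_rpow_of_exponent_le (by linarith) (by linarith [min_le_left ε (1 / 20)])).trans hp
  have hbound := hN n (t n) (p n) (q n) hNn (Nat.succ_pos _) (by positivity)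
    (Real.rpow_lt_one_of_one_lt_of_neg (by linarith) (by linarith)) hqp hD
  calc _ ≤ (SimpleGraph.binomialRandom (Fin n) (p n)).real
        {R | ¬ Rich (t n) (γ' / 4) (γ' / 4 ^ m) R} := by
        refine MeasureTheory.measureReal_mono fun R hR hrich => hR ?_
        refine arrows_of_rich hγ' (min_le_right _ _) hGn ?_ hm ?_ hrich
        · rw [Fintype.card_fin]; omega
        · rw [Fintype.card_fin]; exact two_mul_sq_lt_two_pow n
    _ ≤ 2 ^ (t n * n) * Real.exp (-(c * (n : ℝ) ^ 4 * q n ^ 6)) := hbound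
    _ ≤ Real.exp (t n * n) * Real.exp (-(c * (n : ℝ) ^ 4 * q n ^ 6)) := by
        refine mul_le_mul_of_nonneg_right ?_ (Real.exp_pos _).le
        have h2 : (2 : ℝ) ≤ Real.exp 1 := by linarith [Real.add_one_le_exp (1 : ℝ)]
        calc (2 : ℝ) ^ (t n * n) ≤ Real.exp 1 ^ (t n * n) := pow_le_pow_left₀ (by norm_num) h2 _
          _ = _ := by rw [← Real.exp_nat_mul]; push_cast; ring_nf
    _ = Real.exp (t n * n - c * (n : ℝ) ^ 4 * q n ^ 6) := by rw [← Real.exp_add]; ring_nf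
    _ ≤ _ := Real.exp_le_exp.2 hexp

end DenseAsymptotics

/-! ### Explorations and local sparsity -/

section Exploration

open Finset MeasureTheory

variable {V : Type*} [Fintype V] [DecidableEq V]

/-- A state of an exploration process: the vertices and edges found so far, and a register of at
most four vertices to which the next vertex may be attached. -/
abbrev ExploreState (V : Type*) : Type _ := Finset V × Finset (Sym2 V) × Finset V

/-- Attach a new vertex to some vertices of the register. -/
def growStates (H : ExploreState V) : Finset (ExploreState V) :=
  ((univ ×ˢ H.2.2.powerset ×ˢ H.2.2.powerset).image fun k : V × Finset V × Finset V =>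
    (insert k.1 H.1, H.2.1 ∪ k.2.1.image (fun a => s(k.1, a)), insert k.1 k.2.2)).filter
      fun H' => #H'.2.2 ≤ 4

/-- Add an edge between vertices found before, and reset the register. -/
def chordStates (H : ExploreState V) : Finset (ExploreState V) :=
  (H.1 ×ˢ H.1 ×ˢ H.1 ×ˢ H.1 ×ˢ H.1).image fun k : V × V × V × V × V =>
    (H.1, insert s(k.1, k.2.1) H.2.1, {k.2.2.1, k.2.2.2.1, k.2.2.2.2})

/-- The states reached by attaching `m` vertices and adding `j` chords. -/
def exploreStates : ℕ → ℕ → Finset (ExploreState V)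
  | 0, 0 => univ.image fun v => ({v}, ∅, {v})
  | 0, _ + 1 => ∅
  | m + 1, 0 => (exploreStates m 0).biUnion growStates
  | m + 1, j + 1 => (exploreStates m (j + 1)).biUnion growStates ∪
      (exploreStates (m + 1) j).biUnion chordStates

lemma singleton_mem_exploreStates (v : V) :
    (({v}, ∅, {v}) : ExploreState V) ∈ exploreStates (V := V) 0 0 := by
  rw [exploreStates]; exact mem_image_of_mem _ (mem_univ v)

lemma grow_mem_exploreStates {m j : ℕ} {U r : Finset V} {E : Finset (Sym2 V)}
    (h : (U, E, r) ∈ exploreStates m j) (w : V) {I J : Finset V} (hI : I ⊆ r) (hJ : J ⊆ r)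
    (hc : #(insert w J) ≤ 4) :
    (insert w U, E ∪ I.image (fun a => s(w, a)), insert w J) ∈ exploreStates (m + 1) j := by
  have hg : (insert w U, E ∪ I.image (fun a => s(w, a)), insert w J) ∈ growStates (U, E, r) := by
    refine mem_filter.2 ⟨mem_image.2 ⟨(w, I, J), ?_, rfl⟩, hc⟩
    simp [hI, hJ]
  cases j with
  | zero => rw [exploreStates]; exact mem_biUnion.2 ⟨_, h, hg⟩
  | succ j => rw [exploreStates]; exact mem_union_left _ (mem_biUnion.2 ⟨_, h, hg⟩)

lemma chord_mem_exploreStates {m j : ℕ} {U r : Finset V} {E : Finset (Sym2 V)}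
    (h : (U, E, r) ∈ exploreStates (m + 1) j) {x y : V} (hx : x ∈ U) (hy : y ∈ U)
    {r' : Finset V} (hr' : r' ⊆ U) (hne : r'.Nonempty) (hc : #r' ≤ 3) :
    (U, insert s(x, y) E, r') ∈ exploreStates (m + 1) (j + 1) := by
  have hr : ∃ a b c : V, r' = {a, b, c} := by
    have h0 := card_pos.2 hne
    rcases (by omega : #r' = 1 ∨ #r' = 2 ∨ #r' = 3) with h | h | h
    · obtain ⟨a, rfl⟩ := card_eq_one.1 h; exact ⟨a, a, a, by simp⟩
    · obtain ⟨a, b, -, rfl⟩ := card_eq_two.1 h; exact ⟨a, b, b, by simp⟩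
    · obtain ⟨a, b, c, -, -, -, rfl⟩ := card_eq_three.1 h; exact ⟨a, b, c, rfl⟩
  obtain ⟨a, b, c, rfl⟩ := hr
  rw [exploreStates]
  refine mem_union_right _ (mem_biUnion.2 ⟨_, h, mem_image.2 ⟨(x, y, a, b, c), ?_, rfl⟩⟩)
  simp only [mem_product]
  exact ⟨hx, hy, hr' (by simp), hr' (by simp), hr' (by simp)⟩

lemma card_le_of_mem_exploreStates {m j : ℕ} {H : ExploreState V} (h : H ∈ exploreStates m j) :
    #H.1 ≤ m + 1 ∧ #H.2.2 ≤ 4 := by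
  have hgrow : ∀ {m : ℕ} {H H' : ExploreState V}, #H.1 ≤ m + 1 → H' ∈ growStates H →
      #H'.1 ≤ m + 1 + 1 ∧ #H'.2.2 ≤ 4 := by
    intro m H H' hH hH'
    obtain ⟨h1, h2⟩ := mem_filter.1 hH'
    obtain ⟨k, -, rfl⟩ := mem_image.1 h1
    exact ⟨(card_insert_le _ _).trans (by omega), h2⟩
  induction m generalizing j H with
  | zero =>
    cases j with
    | zero =>
      rw [exploreStates] at h
      obtain ⟨v, -, rfl⟩ := mem_image.1 h
      simp
    | succ j => rw [exploreStates] at h; simp at h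
  | succ m ihm =>
    induction j generalizing H with
    | zero =>
      rw [exploreStates] at h
      obtain ⟨H₀, hH₀, hH⟩ := mem_biUnion.1 h
      exact hgrow (ihm hH₀).1 hH
    | succ j ihj =>
      rw [exploreStates] at h
      rcases mem_union.1 h with h | h
      · obtain ⟨H₀, hH₀, hH⟩ := mem_biUnion.1 h
        exact hgrow (ihm hH₀).1 hH
      · obtain ⟨H₀, hH₀, hH⟩ := mem_biUnion.1 h
        obtain ⟨k, -, rfl⟩ := mem_image.1 hH
        exact ⟨(ihj hH₀).1, card_le_three.trans (by norm_num)⟩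

/-- 256 = 2⁴ · 2⁴ counts the vertices attached to and the vertices kept. The bounded register makes
the cost of a vertex O(n), whatever the size reached. -/
lemma card_growStates_le {H : ExploreState V} (h : #H.2.2 ≤ 4) :
    #(growStates H) ≤ 256 * Fintype.card V := by
  refine (card_filter_le _ _).trans (card_image_le.trans ?_)
  rw [card_product, card_product, card_powerset, card_univ]
  have : 2 ^ #H.2.2 ≤ 2 ^ 4 := Nat.pow_le_pow_right (by norm_num) h
  nlinarith [Nat.mul_le_mul this this, Nat.zero_le (Fintype.card V)]

/-- A chord costs a fifth power: two ends and three register vertices. The sixth power pays for the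
moment at which it is added. -/
lemma card_exploreStates_le (m j : ℕ) :
    #(exploreStates m j : Finset (ExploreState V)) ≤
      (256 * Fintype.card V) ^ (m + 1) * (m + 1) ^ (6 * j) := by
  induction m generalizing j with
  | zero =>
    cases j with
    | zero =>
      rw [exploreStates]
      refine card_image_le.trans ?_
      rw [card_univ]; simp only [zero_add, pow_one, mul_zero, pow_zero, mul_one]; omega
    | succ j => rw [exploreStates]; simp
  | succ m ihm =>
    induction j with
    | zero =>
      rw [exploreStates]
      refine (card_biUnion_le_card_mul _ _ _ fun H hH =>
        card_growStates_le (card_le_of_mem_exploreStates hH).2).trans ?_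
      refine (Nat.mul_le_mul_right _ (ihm 0)).trans (le_of_eq ?_)
      simp only [mul_zero, pow_zero, mul_one]; rw [pow_succ _ (m + 1)]
    | succ j ihj =>
      rw [exploreStates]
      set X := 256 * Fintype.card V
      have h1 := (card_biUnion_le_card_mul (exploreStates (V := V) m (j + 1)) growStates X fun H hH =>
        card_growStates_le (card_le_of_mem_exploreStates hH).2).trans
          (Nat.mul_le_mul_right _ (ihm (j + 1)))
      have h2 := (card_biUnion_le_card_mul (exploreStates (V := V) (m + 1) j) chordStates
        ((m + 1 + 1) ^ 5) fun H hH => by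
          refine card_image_le.trans ?_
          simp only [card_product]
          have := (card_le_of_mem_exploreStates hH).1
          calc #H.1 * (#H.1 * (#H.1 * (#H.1 * #H.1))) = #H.1 ^ 5 := by ring
            _ ≤ _ := Nat.pow_le_pow_left this 5).trans (Nat.mul_le_mul_right _ ihj)
      refine (card_union_le _ _).trans ((add_le_add h1 h2).trans ?_)
      have h3 : (m + 1) ^ (6 * j + 5) ≤ (m + 1 + 1) ^ (6 * j + 5) :=
        Nat.pow_le_pow_left (by omega) _
      calc X ^ (m + 1) * (m + 1) ^ (6 * (j + 1)) * X +
            X ^ (m + 1 + 1) * (m + 1 + 1) ^ (6 * j) * (m + 1 + 1) ^ 5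
          = X ^ (m + 1 + 1) * ((m + 1) * (m + 1) ^ (6 * j + 5) + (m + 1 + 1) ^ (6 * j + 5)) := by
            ring
        _ ≤ X ^ (m + 1 + 1) *
            ((m + 1) * (m + 1 + 1) ^ (6 * j + 5) + (m + 1 + 1) ^ (6 * j + 5)) := by gcongr
        _ = _ := by ring

/-- The exploration finds no part of `R` with at least twice as many edges as vertices. -/
def LocallySparse (R : SimpleGraph V) : Prop :=
  ∀ m < Fintype.card V, ∀ j < 4, ∀ H ∈ exploreStates (V := V) m j,
    (H.2.1 : Set (Sym2 V)) ⊆ R.edgeSet → #H.2.1 < 2 * (m + 1)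

lemma binomialRandom_real_exists_state_le (p : unitInterval) (m j l : ℕ) :
    (SimpleGraph.binomialRandom V p).real {R | ∃ H ∈ exploreStates (V := V) m j,
      l ≤ #H.2.1 ∧ (H.2.1 : Set (Sym2 V)) ⊆ R.edgeSet} ≤
        ((256 * Fintype.card V) ^ (m + 1) * (m + 1) ^ (6 * j) : ℕ) * (p : ℝ) ^ l := by
  refine (binomialRandom_real_exists_le p _ _).trans ?_
  refine (Finset.sum_le_card_nsmul _ _ ((p : ℝ) ^ l) fun H _ => ?_).trans ?_
  · by_cases hl : l ≤ #H.2.1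
    · refine le_trans (measureReal_mono fun R hR => hR.2)
        ((binomialRandom_real_subset_le p H.2.1).trans (pow_le_pow_of_le_one p.2.1 p.2.2 hl))
    · have : ({R | l ≤ #H.2.1 ∧ (H.2.1 : Set (Sym2 V)) ⊆ R.edgeSet} : Set (SimpleGraph V)) = ∅ := by
        ext R; simp [hl]
      rw [this, measureReal_empty]
      exact pow_nonneg p.2.1 _
  · rw [nsmul_eq_mul]
    exact mul_le_mul_of_nonneg_right (Nat.cast_le.2 (card_exploreStates_le m j))
      (pow_nonneg p.2.1 _)

lemma sum_pow_succ_le {x : ℝ} (h0 : 0 ≤ x) (h1 : x ≤ 1 / 2) (n : ℕ) :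
    ∑ m ∈ range n, x ^ (m + 1) ≤ 2 * x := by
  have h : ∑ m ∈ range n, x ^ (m + 1) ≤ 2 * x - x ^ n * (2 * x) := by
    induction n with
    | zero => simp
    | succ n ih =>
      rw [sum_range_succ]
      have := pow_nonneg h0 n
      have h2 : x ^ (n + 1) = x ^ n * x := pow_succ _ _
      have h3 : x ^ n * x * x ≤ x ^ n * x * (1 / 2) := by gcongr
      rw [h2]
      nlinarith
  have : 0 ≤ x ^ n * (2 * x) := by positivity
  linarith

/-- With at most three chords the polynomial factor is at most (m+1)^18 ≤ 2^(18(m+1)), and 256 ·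
2^18 = 2^26. The expected number of bad states is then a geometric series for each of the four
values of `j`. -/
theorem binomialRandom_real_not_locallySparse_le (p : unitInterval)
    (hx : 2 ^ 26 * (Fintype.card V : ℝ) * (p : ℝ) ^ 2 ≤ 1 / 2) :
    (SimpleGraph.binomialRandom V p).real {R | ¬ LocallySparse R} ≤
      8 * (2 ^ 26 * (Fintype.card V : ℝ) * (p : ℝ) ^ 2) := by
  set n := Fintype.card V with hn
  set x : ℝ := 2 ^ 26 * (n : ℝ) * (p : ℝ) ^ 2 with hxdef
  have hx0 : 0 ≤ x := by positivity
  have hp0 := p.2.1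
  set P : ℕ × ℕ → SimpleGraph V → Prop := fun k R => ∃ H ∈ exploreStates (V := V) k.1 k.2,
    2 * (k.1 + 1) ≤ #H.2.1 ∧ (H.2.1 : Set (Sym2 V)) ⊆ R.edgeSet with hP
  have hincl : ({R | ¬ LocallySparse R} : Set (SimpleGraph V)) ⊆
      {R | ∃ k ∈ range n ×ˢ range 4, P k R} := by
    intro R hR
    have hR' : ¬ LocallySparse R := hR
    unfold LocallySparse at hR'
    push Not at hR'
    obtain ⟨m, hm, j, hj, H, hH, hHR, hbad⟩ := hR'
    exact ⟨(m, j), mem_product.2 ⟨mem_range.2 hm, mem_range.2 hj⟩, H, hH, hbad, hHR⟩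
  have hcard : ∀ m j : ℕ, j < 4 →
      (((256 * n) ^ (m + 1) * (m + 1) ^ (6 * j) : ℕ) : ℝ) ≤ (2 ^ 26 * (n : ℝ)) ^ (m + 1) := by
    intro m j hj
    have h1 : (m + 1) ^ (6 * j) ≤ (2 ^ 18) ^ (m + 1) := by
      calc (m + 1) ^ (6 * j) ≤ (m + 1) ^ 18 := Nat.pow_le_pow_right (by omega) (by omega)
        _ ≤ (2 ^ (m + 1)) ^ 18 := Nat.pow_le_pow_left Nat.lt_two_pow_self.le _
        _ = _ := by rw [← pow_mul, ← pow_mul, mul_comm]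
    have h2 : (256 * n) ^ (m + 1) * (m + 1) ^ (6 * j) ≤ (2 ^ 26 * n) ^ (m + 1) := by
      calc _ ≤ (256 * n) ^ (m + 1) * (2 ^ 18) ^ (m + 1) := Nat.mul_le_mul_left _ h1
        _ = (2 ^ 26 * n) ^ (m + 1) := by rw [← mul_pow]; ring_nf
    exact_mod_cast h2
  have hterm : ∀ k ∈ range n ×ˢ range 4,
      (SimpleGraph.binomialRandom V p).real {R | P k R} ≤ x ^ (k.1 + 1) := by
    rintro ⟨m, j⟩ hk
    have hj : j < 4 := by simpa using (mem_product.1 hk).2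
    refine (binomialRandom_real_exists_state_le p m j _).trans ?_
    refine (mul_le_mul_of_nonneg_right (hcard m j hj) (by positivity)).trans (le_of_eq ?_)
    rw [pow_mul, ← mul_pow]
  calc _ ≤ (SimpleGraph.binomialRandom V p).real {R | ∃ k ∈ range n ×ˢ range 4, P k R} :=
        measureReal_mono hincl
    _ ≤ ∑ k ∈ range n ×ˢ range 4, (SimpleGraph.binomialRandom V p).real {R | P k R} :=
        binomialRandom_real_exists_le _ _ _
    _ ≤ ∑ k ∈ range n ×ˢ range 4, x ^ (k.1 + 1) := Finset.sum_le_sum hterm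
    _ = 4 * ∑ m ∈ range n, x ^ (m + 1) := by
        rw [Finset.sum_product]
        simp only [Finset.sum_const, card_range, nsmul_eq_mul, ← Finset.mul_sum]
        push_cast; ring
    _ ≤ 4 * (2 * x) := by gcongr; exact sum_pow_succ_le hx0 hx n
    _ = _ := by ring

end Exploration

/-- Below the density `n ^ (-1 / 2)`, random graphs are locally sparse. -/
theorem aas_locallySparse {p : ℕ → unitInterval}
    (hp : (fun n : ℕ => (p n : ℝ)) =o[atTop] (fun n : ℕ => (n : ℝ) ^ (-(1 / 2 : ℝ)))) :
    AAS p (fun _ R => LocallySparse R) := by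
  set x : ℕ → ℝ := fun n => 2 ^ 26 * (n : ℝ) * (p n : ℝ) ^ 2 with hx
  have hxt : Tendsto x atTop (𝓝 0) := by
    have h1 := (hp.tendsto_div_nhds_zero.pow 2).const_mul ((2 : ℝ) ^ 26)
    rw [zero_pow two_ne_zero, mul_zero] at h1
    refine h1.congr' ?_
    filter_upwards [eventually_ge_atTop 1] with n hn
    have hn' : (0 : ℝ) < n := by exact_mod_cast hn
    have h2 : ((n : ℝ) ^ (-(1 / 2 : ℝ))) ^ 2 = (n : ℝ)⁻¹ := by
      rw [← Real.rpow_natCast, ← Real.rpow_mul hn'.le, ← Real.rpow_neg_one]; norm_num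
    rw [div_pow, h2, hx, div_inv_eq_mul]; ring
  refine aas_of_tendsto (fun n => 8 * x n) (by simpa using hxt.const_mul 8) ?_
  filter_upwards [hxt.eventually_le_const (show (0 : ℝ) < 1 / 2 by norm_num)] with n h1
  have h3 := binomialRandom_real_not_locallySparse_le (V := Fin n) (p n)
    (by rw [Fintype.card_fin]; exact h1)
  rw [Fintype.card_fin] at h3
  exact h3

/-! ### Growing systems of overlapping cliques -/

section Blocks

open Finset

variable {V : Type*} [Fintype V] [DecidableEq V]

/-- The exploration may attach all missing vertices of a block, if the register holds the vertices
of the block found before. -/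
lemma exists_block_mem_exploreStates {B : Finset V} (hB4 : #B ≤ 4) {m j : ℕ} {U r : Finset V}
    {E : Finset (Sym2 V)} (h : (U, E, r) ∈ exploreStates m j) (hU : #U = m + 1)
    (hE : ∀ e ∈ E, ∀ v ∈ e, v ∈ U) (hBr : B ∩ U ⊆ r) (hne : ¬ B ⊆ U) :
    ∃ E', (U ∪ B, E', B) ∈ exploreStates (m + #(B \ U)) j ∧ #(U ∪ B) = m + #(B \ U) + 1 ∧
      E ⊆ E' ∧ (∀ e ∈ E', e ∈ E ∨ (¬ e.IsDiag ∧ ∀ v ∈ e, v ∈ B)) ∧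
      #E' + (#(B ∩ U)).choose 2 = #E + (#B).choose 2 := by
  induction hd : #(B \ U) generalizing m U E r with
  | zero => exact absurd (sdiff_eq_empty_iff_subset.1 (card_eq_zero.1 hd)) hne
  | succ d ih =>
    obtain ⟨w, hw⟩ : (B \ U).Nonempty := card_pos.1 (by omega)
    obtain ⟨hwB, hwU⟩ := mem_sdiff.1 hw
    have hins : insert w (B ∩ U) = B ∩ insert w U := (inter_insert_of_mem hwB).symm
    have hcardI : #(B ∩ insert w U) = #(B ∩ U) + 1 := by
      rw [← hins, card_insert_of_notMem fun h => hwU (mem_inter.1 h).2]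
    have hc4 : #(insert w (B ∩ U)) ≤ 4 := by
      rw [hins]; exact (card_le_card inter_subset_left).trans hB4
    have h1 := grow_mem_exploreStates h w hBr hBr hc4
    set E₁ := E ∪ (B ∩ U).image fun a => s(w, a) with hE₁
    have hU₁ : #(insert w U) = m + 1 + 1 := by rw [card_insert_of_notMem hwU, hU]
    -- The edges at `w` are new because `w` has not been found before.
    have hE₁card : #E₁ = #E + #(B ∩ U) := by
      rw [hE₁, card_union_of_disjoint, card_image_of_injective]
      · exact fun a b hab => Sym2.congr_right.1 hab
      · rw [Finset.disjoint_left]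
        intro e he he'
        obtain ⟨a, -, rfl⟩ := mem_image.1 he'
        exact hwU (hE _ he w (Sym2.mem_mk_left w a))
    have hE₁mem : ∀ e ∈ E₁, e ∈ E ∨ (¬ e.IsDiag ∧ ∀ v ∈ e, v ∈ B) := by
      intro e he
      rcases mem_union.1 he with he | he
      · exact Or.inl he
      · obtain ⟨a, ha, rfl⟩ := mem_image.1 he
        obtain ⟨haB, haU⟩ := mem_inter.1 ha
        refine Or.inr ⟨fun h => hwU ?_, fun v hv => ?_⟩
        · rw [Sym2.mk_isDiag_iff] at h; exact h ▸ haU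
        · rcases Sym2.mem_iff.1 hv with rfl | rfl <;> assumption
    have hE₁U : ∀ e ∈ E₁, ∀ v ∈ e, v ∈ insert w U := by
      intro e he v hv
      rcases mem_union.1 he with he | he
      · exact mem_insert_of_mem (hE e he v hv)
      · obtain ⟨a, ha, rfl⟩ := mem_image.1 he
        rcases Sym2.mem_iff.1 hv with rfl | rfl
        exacts [mem_insert_self _ _, mem_insert_of_mem (mem_inter.1 ha).2]
    have hd₁ : #(B \ insert w U) = d := by
      rw [sdiff_insert, card_erase_of_mem hw, hd]; rfl
    have hunion : insert w U ∪ B = U ∪ B := by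
      rw [insert_union, insert_eq_of_mem (mem_union_right _ hwB)]
    have hchoose : (#(B ∩ insert w U)).choose 2 = (#(B ∩ U)).choose 2 + #(B ∩ U) := by
      rw [hcardI, Nat.choose_succ_succ' _ 1, Nat.choose_one_right, add_comm]
    by_cases hsub : B ⊆ insert w U
    · have hBI : B ∩ insert w U = B := inter_eq_left.2 hsub
      have hd0 : d = 0 := by
        rw [← hd₁, sdiff_eq_empty_iff_subset.2 hsub, card_empty]
      have hUB : U ∪ B = insert w U := by rw [← hunion, union_eq_left.2 hsub]
      subst hd0
      refine ⟨E₁, ?_, by rw [hUB, hU₁], subset_union_left, hE₁mem, ?_⟩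
      · rw [hUB]; rw [hins, hBI] at h1; exact h1
      · rw [hBI] at hchoose; omega
    · rw [hins] at h1
      obtain ⟨E', h2, h3, h4, h5, h6⟩ := ih h1 hU₁ hE₁U subset_rfl hsub hd₁
      rw [hunion] at h2 h3
      refine ⟨E', ?_, by omega, subset_union_left.trans h4, ?_, ?_⟩
      · rw [show m + (d + 1) = m + 1 + d by omega]; exact h2
      · intro e he
        exact (h5 e he).elim (hE₁mem e) Or.inr
      · omega

/-- The last chord resets the register, so at least one is needed to choose `r'` freely. -/
lemma union_mem_exploreStates {m j : ℕ} {U r r' : Finset V} {E D : Finset (Sym2 V)}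
    (h : (U, E, r) ∈ exploreStates (m + 1) j) (hD : ∀ e ∈ D, ∀ v ∈ e, v ∈ U) (hDne : D.Nonempty)
    (hr' : r' ⊆ U) (hne : r'.Nonempty) (hc : #r' ≤ 3) :
    (U, E ∪ D, r') ∈ exploreStates (m + 1) (j + #D) := by
  induction D using Finset.induction_on with
  | empty => exact absurd hDne (by simp)
  | insert e D heD ih =>
    have key : ∀ {j : ℕ} {E r}, (U, E, r) ∈ exploreStates (m + 1) j →
        (U, insert e E, r') ∈ exploreStates (m + 1) (j + 1) := by
      intro j E r h
      have he := hD e (mem_insert_self _ _)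
      induction e using Sym2.ind with
      | _ x y =>
        exact chord_mem_exploreStates h (he x (Sym2.mem_mk_left x y))
          (he y (Sym2.mem_mk_right x y)) hr' hne hc
    rw [card_insert_of_notMem heD, union_insert]
    rcases D.eq_empty_or_nonempty with rfl | hDne'
    · simpa using key h
    · exact key (ih (fun e' he' => hD e' (mem_insert_of_mem he')) hDne')

open Classical in
/-- The edges of `F` inside `U`. -/
noncomputable def edgesInside (F : SimpleGraph V) (U : Finset V) : Finset (Sym2 V) :=
  univ.filter fun e => e ∈ F.edgeSet ∧ ∀ v ∈ e, v ∈ U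

lemma mem_edgesInside {F : SimpleGraph V} {U : Finset V} {e : Sym2 V} :
    e ∈ edgesInside F U ↔ e ∈ F.edgeSet ∧ ∀ v ∈ e, v ∈ U := by
  simp [edgesInside]

/-- An explored part of `F`, made of blocks, with few edges in excess of those forced by the
exploration, and such that some vertex `w` of the last block has no neighbours in other blocks. -/
structure IsFresh (F : SimpleGraph V) (𝓑 : Finset (Finset V)) (m j : ℕ) (U : Finset V)
    (E : Finset (Sym2 V)) (B : Finset V) (w : V) : Prop where
  mem : (U, E, B) ∈ exploreStates m j
  card_eq : #U = m + 1
  subset : E ⊆ edgesInside F U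
  block_mem : B ∈ 𝓑
  block_subset : B ⊆ U
  mem_block : w ∈ B
  neighbor_mem : ∀ e ∈ E, w ∈ e → ∀ v ∈ e, v ∈ B
  covered : ∀ v ∈ U, ∃ B ∈ 𝓑, v ∈ B ∧ B ⊆ U
  le_two : j ≤ 2
  excess : 2 * (m + 1) + j ≤ #E + 3

/-- A locally sparse graph has no subgraph which is generated by a system of overlapping cliques of
size `r`, in which each clique meets further ones in at least `s` vertices around each of its
vertices, and in which unions closed under overlaps are dense. -/
theorem eq_empty_of_locallySparse {R F : SimpleGraph V} (hR : LocallySparse R) (hFR : F ≤ R)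
    {𝓑 : Finset (Finset V)} {r s : ℕ} (hr : r ≤ 4) (hr2 : 2 ≤ r) (hs : 1 ≤ s)
    (hnum : ∀ i < r, s ≤ i → 2 * (r - i) + i.choose 2 ≤ r.choose 2) (hnum0 : 2 * r ≤ r.choose 2 + 3)
    (hcl : ∀ B ∈ 𝓑, F.IsClique (B : Set V)) (hcard : ∀ B ∈ 𝓑, #B = r)
    (hnext : ∀ B₀ ∈ 𝓑, ∀ w ∈ B₀, ∃ B ∈ 𝓑, B ≠ B₀ ∧ w ∈ B ∧ s ≤ #(B ∩ B₀))
    (hclosed : ∀ U : Finset V, (∃ B ∈ 𝓑, B ⊆ U) → (∀ v ∈ U, ∃ B ∈ 𝓑, v ∈ B ∧ B ⊆ U) →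
      (∀ B ∈ 𝓑, s ≤ #(B ∩ U) → B ⊆ U) → 2 * #U ≤ #(edgesInside F U)) : 𝓑 = ∅ := by
  by_contra hne
  obtain ⟨B, hB⟩ := nonempty_iff_ne_empty.2 hne
  have hsparse : ∀ {m j : ℕ} {U r : Finset V} {E : Finset (Sym2 V)}, (U, E, r) ∈ exploreStates m j →
      j ≤ 3 → #U = m + 1 → E ⊆ edgesInside F U → #E < 2 * (m + 1) := by
    intro m j U r E h hj hU hE
    refine hR m ?_ j (by omega) _ h fun e he => ?_
    · have := card_le_univ U; omega
    · exact SimpleGraph.edgeSet_mono hFR (mem_edgesInside.1 (hE he)).1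
  have hclmem : ∀ B ∈ 𝓑, ∀ e : Sym2 V, ¬ e.IsDiag → (∀ v ∈ e, v ∈ B) → e ∈ F.edgeSet := by
    intro B hB e he hv
    induction e using Sym2.ind with
    | _ x y =>
      exact hcl B hB (hv x (Sym2.mem_mk_left x y)) (hv y (Sym2.mem_mk_right x y)) he
  -- attaching a block to a part of `F` gives a fresh state
  have hattach : ∀ {m j : ℕ} {U ρ : Finset V} {E : Finset (Sym2 V)}, (U, E, ρ) ∈ exploreStates m j →
      #U = m + 1 → E ⊆ edgesInside F U → (∀ v ∈ U, ∃ B ∈ 𝓑, v ∈ B ∧ B ⊆ U) → j ≤ 2 →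
      2 * (m + 1) + j ≤ #E + 3 → ∀ B ∈ 𝓑, s ≤ #(B ∩ U) → B ∩ U ⊆ ρ → ¬ B ⊆ U →
      ∃ m' > m, ∃ j U E B w, IsFresh F 𝓑 m' j U E B w := by
    intro m j U ρ E h hU hE hcov hj hex B hB hsB hBρ hBU
    obtain ⟨E', h1, h2, h3, h4, h5⟩ := exists_block_mem_exploreStates
      ((hcard B hB).le.trans hr) h hU (fun e he => (mem_edgesInside.1 (hE he)).2) hBρ hBU
    -- A vertex new in this step has explored edges only within its block.
    obtain ⟨w, hw⟩ : (B \ U).Nonempty := by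
      rw [nonempty_iff_ne_empty]; exact fun h => hBU (sdiff_eq_empty_iff_subset.1 h)
    obtain ⟨hwB, hwU⟩ := mem_sdiff.1 hw
    have hpos : 0 < #(B \ U) := card_pos.2 ⟨w, hw⟩
    have hsum := card_inter_add_card_sdiff B U
    rw [hcard B hB] at hsum h5
    -- The block brings at least two new edges per new vertex, so the bound on the excess persists.
    have hi := hnum (#(B ∩ U)) (by omega) hsB
    refine ⟨m + #(B \ U), by omega, j, U ∪ B, E', B, w, h1, h2, ?_, hB, subset_union_right, hwB,
      ?_, ?_, hj, by omega⟩
    · intro e he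
      rcases h4 e he with h | ⟨h, hv⟩
      · obtain ⟨h6, h7⟩ := mem_edgesInside.1 (hE h)
        exact mem_edgesInside.2 ⟨h6, fun v hv => mem_union_left _ (h7 v hv)⟩
      · exact mem_edgesInside.2 ⟨hclmem B hB e h hv, fun v hv' => mem_union_right _ (hv v hv')⟩
    · intro e he hwe
      rcases h4 e he with h | ⟨-, hv⟩
      · exact absurd ((mem_edgesInside.1 (hE h)).2 w hwe) hwU
      · exact hv
    · intro v hv
      rcases mem_union.1 hv with hv | hv
      · obtain ⟨B', h6, h7, h8⟩ := hcov v hv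
        exact ⟨B', h6, h7, h8.trans subset_union_left⟩
      · exact ⟨B, hB, hv, subset_union_right⟩
  have hstart : ∃ m j U E B w, IsFresh F 𝓑 m j U E B w := by
    have hBr := hcard B hB
    obtain ⟨v, hv⟩ : B.Nonempty := card_pos.1 (by omega)
    have hBv : B ∩ {v} = {v} := inter_eq_right.2 (singleton_subset_iff.2 hv)
    obtain ⟨E', h1, h2, -, h4, h5⟩ := exists_block_mem_exploreStates (hBr.le.trans hr)
      (singleton_mem_exploreStates v) (by simp) (by simp) inter_subset_right (fun h => by
        have := card_le_card h
        rw [card_singleton] at this; omega)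
    have hvB : {v} ∪ B = B := union_eq_right.2 (singleton_subset_iff.2 hv)
    rw [hvB] at h1 h2
    rw [hBv, card_singleton, hBr] at h5
    have h6 : Nat.choose 1 2 = 0 := rfl
    obtain ⟨w, hw⟩ : B.Nonempty := ⟨v, hv⟩
    refine ⟨_, 0, B, E', B, w, h1, h2, ?_, hB, subset_rfl, hw, ?_, ?_, by omega, ?_⟩
    · intro e he
      rcases h4 e he with h | ⟨h, hv⟩
      · simp at h
      · exact mem_edgesInside.2 ⟨hclmem B hB e h hv, hv⟩
    · intro e he _
      rcases h4 e he with h | ⟨h, hv⟩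
      · simp at h
      · exact hv
    · exact fun v hv => ⟨B, hB, hv, subset_rfl⟩
    · rw [card_empty] at h5; omega
  have hstep : ∀ {m j U E B w}, IsFresh F 𝓑 m j U E B w →
      ∃ m' > m, ∃ j U E B w, IsFresh F 𝓑 m' j U E B w := by
    intro m j U E B₀ w hF
    by_cases hsat : edgesInside F U ⊆ E
    · obtain ⟨B, hB, hBne, hwB, hBs⟩ := hnext B₀ hF.block_mem w hF.mem_block
      -- All edges of `F` inside `U` are explored, so a vertex of `B` in `U` is an explored
      -- neighbour of `w` and lies in `B₀`, which is the register. Hence `B` can be attached without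
      -- a chord.
      have hBU : B ∩ U ⊆ B₀ := by
        intro v hv
        obtain ⟨hvB, hvU⟩ := mem_inter.1 hv
        by_cases hvw : w = v
        · exact hvw ▸ hF.mem_block
        · refine hF.neighbor_mem s(w, v) (hsat (mem_edgesInside.2 ⟨hcl B hB hwB hvB hvw, ?_⟩))
            (Sym2.mem_mk_left _ _) v (Sym2.mem_mk_right _ _)
          intro u hu
          rcases Sym2.mem_iff.1 hu with rfl | rfl
          exacts [hF.block_subset hF.mem_block, hvU]
      refine hattach hF.mem hF.card_eq hF.subset hF.covered hF.le_two hF.excess B hB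
        (hBs.trans (card_le_card (inter_subset_inter_left hF.block_subset))) hBU fun hsub => hBne ?_
      refine eq_of_subset_of_card_le ?_ (by rw [hcard B hB, hcard B₀ hF.block_mem])
      rwa [inter_eq_left.2 hsub] at hBU
    · set D := edgesInside F U \ E with hD
      have hDne : D.Nonempty := by
        rw [nonempty_iff_ne_empty]; exact fun h => hsat (sdiff_eq_empty_iff_subset.1 h)
      have hDcard : #(edgesInside F U) = #E + #D := by
        rw [hD, card_sdiff_of_subset hF.subset]
        have := card_le_card hF.subset
        omega
      have hEsp := hsparse hF.mem (by have := hF.le_two; omega) hF.card_eq hF.subset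
      have hDU : ∀ D' ⊆ D, ∀ e ∈ D', ∀ v ∈ e, v ∈ U := fun D' hD' e he =>
        (mem_edgesInside.1 (mem_sdiff.1 (hD' he)).1).2
      have hex := hF.excess
      have hj2 := hF.le_two
      obtain ⟨k, rfl⟩ : ∃ k, m = k + 1 := ⟨m - 1, by
        have h1 := card_le_card hF.block_subset
        rw [hcard _ hF.block_mem, hF.card_eq] at h1; omega⟩
      -- By the excess bound, reaching twice the number of vertices takes at most 3 - j further
      -- chords, so at most three in total, which local sparsity forbids.
      have hEf : #(edgesInside F U) < 2 * (k + 1 + 1) := by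
        by_contra hge
        obtain ⟨D', hD', hD'card⟩ := exists_subset_card_eq
          (show 2 * (k + 1 + 1) - #E ≤ #D by omega)
        have h1 := union_mem_exploreStates hF.mem (hDU D' hD') (card_pos.1 (by omega))
          (singleton_subset_iff.2 (hF.block_subset hF.mem_block)) (singleton_nonempty w) (by simp)
        have h2 := hsparse h1 (by omega) hF.card_eq
          (union_subset hF.subset (hD'.trans sdiff_subset))
        rw [card_union_of_disjoint
          (disjoint_of_subset_right hD' disjoint_sdiff)] at h2
        omega
      obtain ⟨B, hB, hBs, hBU⟩ : ∃ B ∈ 𝓑, s ≤ #(B ∩ U) ∧ ¬ B ⊆ U := by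
        by_contra hcon
        push Not at hcon
        have := hclosed U ⟨B₀, hF.block_mem, hF.block_subset⟩ hF.covered hcon
        rw [hF.card_eq] at this
        omega
      have hBU4 : #(B ∩ U) ≤ 3 := by
        have h1 : #(B ∩ U) < #B := card_lt_card
          (Finset.ssubset_iff_subset_ne.2 ⟨inter_subset_left, fun h => hBU (inter_eq_left.1 h)⟩)
        rw [hcard B hB] at h1; omega
      -- All missing edges become chords, and the register is reset to the trace of `B`. As the
      -- edges stay below twice the number of vertices, the excess bound leaves at most two chords.
      have h1 := union_mem_exploreStates hF.mem (hDU D subset_rfl) hDne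
        (inter_subset_right (s₁ := B)) (card_pos.1 (by omega)) hBU4
      rw [hD, union_sdiff_of_subset hF.subset, ← hD] at h1
      exact hattach h1 hF.card_eq subset_rfl hF.covered (by omega) (by omega) B hB hBs subset_rfl hBU
  have hall : ∀ k, ∃ m ≥ k, ∃ j U E B w, IsFresh F 𝓑 m j U E B w := by
    intro k
    induction k with
    | zero => obtain ⟨m, h⟩ := hstart; exact ⟨m, Nat.zero_le _, h⟩
    | succ k ih =>
      obtain ⟨m, hm, j, U, E, B, w, h⟩ := ih
      obtain ⟨m', hm', h'⟩ := hstep h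
      exact ⟨m', by omega, h'⟩
  obtain ⟨m, hm, j, U, E, B, w, h⟩ := hall (Fintype.card V)
  have h1 := card_le_univ U
  rw [h.card_eq] at h1
  omega

end Blocks

/-! ### Colourings of locally sparse graphs -/

section Colorings

open Finset

variable {V : Type*} [Fintype V] [DecidableEq V]

lemma two_mul_card_le_card_edgesInside {F : SimpleGraph V} {U : Finset V}
    (h : ∀ v ∈ U, ∃ N ⊆ U, 4 ≤ #N ∧ ∀ w ∈ N, F.Adj v w) : 2 * #U ≤ #(edgesInside F U) := by
  classical
  let H : SimpleGraph V :=
    { Adj := fun a b => F.Adj a b ∧ a ∈ U ∧ b ∈ U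
      symm := ⟨fun a b h => ⟨h.1.symm, h.2.2, h.2.1⟩⟩
      loopless := ⟨fun a h => F.loopless.irrefl a h.1⟩ }
  have hE : edgesInside F U = H.edgeFinset := by
    ext e
    rw [mem_edgesInside, SimpleGraph.mem_edgeFinset]
    induction e using Sym2.ind with
    | _ x y =>
      simp only [SimpleGraph.mem_edgeSet, Sym2.mem_iff, forall_eq_or_imp, forall_eq]
      exact Iff.rfl
  have hsum := H.sum_degrees_eq_twice_card_edges
  have hdeg : #U * 4 ≤ ∑ v, H.degree v := by
    refine le_trans ?_ (Finset.sum_le_sum_of_subset (subset_univ U))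
    rw [← smul_eq_mul]
    refine Finset.card_nsmul_le_sum _ _ _ fun v hv => ?_
    obtain ⟨N, hN, hN4, hNadj⟩ := h v hv
    refine hN4.trans (card_le_card fun w hw => ?_)
    rw [SimpleGraph.mem_neighborFinset]
    exact ⟨hNadj w hw, hv, hN hw⟩
  rw [hE]
  omega

/-- The three edges of a triangle have the same colour. -/
def TriangleMono (c : Sym2 V → Bool) (a b d : V) : Prop :=
  c s(a, b) = c s(b, d) ∧ c s(b, d) = c s(a, d)

lemma TriangleMono.rotate {c : Sym2 V → Bool} {a b d : V} (h : TriangleMono c a b d) :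
    TriangleMono c b d a := by
  obtain ⟨h1, h2⟩ := h
  rw [TriangleMono, Sym2.eq_swap (a := d) (b := a), Sym2.eq_swap (a := b) (b := a)]
  exact ⟨h2, h2.symm.trans h1.symm⟩

/-- There is a colouring of the pairs of vertices without monochromatic triangles in `F`. -/
def TriangleColorable (F : SimpleGraph V) : Prop :=
  ∃ c : Sym2 V → Bool, ∀ a b d, F.Adj a b → F.Adj b d → F.Adj a d → ¬ TriangleMono c a b d

section Critical

variable {F : SimpleGraph V}

/-- If every triangle on `uv` went through `x`, a colouring of `F` without `uv` would extend by
giving `uv` the colour opposite to that of `ux`. -/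
lemma exists_ne_adj_adj_of_critical (hF : ¬ TriangleColorable F)
    (hmin : ∀ F' < F, TriangleColorable F') {u v : V} (huv : F.Adj u v) (x : V) :
    ∃ y ≠ x, F.Adj u y ∧ F.Adj v y := by
  by_contra hcon
  push Not at hcon
  have hx : ∀ y, F.Adj u y → F.Adj v y → y = x := fun y h1 h2 => by
    by_contra h; exact hcon y h h1 h2
  obtain ⟨c, hc⟩ := hmin (F.deleteEdges {s(u, v)}) (lt_of_le_of_ne (F.deleteEdges_le _) fun h => by
    have : (F.deleteEdges {s(u, v)}).Adj u v := h.symm ▸ huv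
    rw [SimpleGraph.deleteEdges_adj] at this
    exact this.2 rfl)
  set c' : Sym2 V → Bool := Function.update c s(u, v) (!c s(u, x)) with hc'
  have hmain : ∀ a b d, F.Adj a b → F.Adj b d → F.Adj a d → s(a, b) = s(u, v) →
      ¬ TriangleMono c' a b d := by
    intro a b d hab hbd had he
    have h1 : s(b, d) ≠ s(u, v) := by
      rw [← he]; intro h
      rcases Sym2.eq_iff.1 h with ⟨rfl, -⟩ | ⟨-, rfl⟩
      exacts [hab.ne rfl, had.ne rfl]
    have h2 : s(a, d) ≠ s(u, v) := by
      rw [← he]; intro h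
      rcases Sym2.eq_iff.1 h with ⟨-, rfl⟩ | ⟨rfl, -⟩
      exacts [hbd.ne rfl, hab.ne rfl]
    rw [TriangleMono, he, hc', Function.update_self, Function.update_of_ne h1,
      Function.update_of_ne h2]
    rcases Sym2.eq_iff.1 he with ⟨rfl, rfl⟩ | ⟨rfl, rfl⟩
    · rw [hx d had hbd]
      intro h
      rw [h.2] at h
      exact absurd h.1 (by simp)
    · rw [hx d hbd had]
      intro h
      exact absurd h.1 (by simp)
  refine hF ⟨c', fun a b d hab hbd had hm => ?_⟩
  by_cases h1 : s(a, b) = s(u, v)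
  · exact hmain a b d hab hbd had h1 hm
  by_cases h2 : s(b, d) = s(u, v)
  · exact hmain b d a hbd had.symm hab.symm h2 hm.rotate
  by_cases h3 : s(d, a) = s(u, v)
  · exact hmain d a b had.symm hab hbd.symm h3 hm.rotate.rotate
  have h3' : s(a, d) ≠ s(u, v) := by rwa [Sym2.eq_swap]
  refine hc a b d ?_ ?_ ?_ ?_
  · rw [SimpleGraph.deleteEdges_adj]; exact ⟨hab, h1⟩
  · rw [SimpleGraph.deleteEdges_adj]; exact ⟨hbd, h2⟩
  · rw [SimpleGraph.deleteEdges_adj]; exact ⟨had, h3'⟩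
  · rw [TriangleMono, hc', Function.update_of_ne h1, Function.update_of_ne h2,
      Function.update_of_ne h3'] at hm
    exact hm

-- Otherwise the neighbourhood of `v` would be a triangle, by the previous lemma, and a colouring of
-- `F` without `v` would extend to `v`.
open Classical in
lemma four_le_degree_of_critical (hF : ¬ TriangleColorable F)
    (hmin : ∀ F' < F, TriangleColorable F') {v a : V} (hva : F.Adj v a) : 4 ≤ F.degree v := by
  by_contra hlt
  obtain ⟨b, -, hvb, hab⟩ := exists_ne_adj_adj_of_critical hF hmin hva a
  obtain ⟨d, hdb, hvd, had⟩ := exists_ne_adj_adj_of_critical hF hmin hva b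
  have hsub : ({a, b, d} : Finset V) ⊆ F.neighborFinset v := by
    intro y hy
    rw [SimpleGraph.mem_neighborFinset]
    simp only [mem_insert, mem_singleton] at hy
    rcases hy with rfl | rfl | rfl <;> assumption
  have hcard : #({a, b, d} : Finset V) = 3 := card_eq_three.2 ⟨a, b, d, hab.ne, had.ne, hdb.symm, rfl⟩
  have hN : ∀ y, F.Adj v y → y = a ∨ y = b ∨ y = d := by
    have heq := eq_of_subset_of_card_le hsub (by
      rw [hcard, SimpleGraph.card_neighborFinset_eq_degree]; omega)
    intro y hy
    have := (F.mem_neighborFinset v y).2 hy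
    rw [← heq] at this
    simpa using this
  have hbd : F.Adj b d := by
    obtain ⟨y, hya, hvy, hby⟩ := exists_ne_adj_adj_of_critical hF hmin hvb a
    rcases hN y hvy with rfl | rfl | rfl
    exacts [absurd rfl hya, absurd rfl hby.ne, hby]
  let H : SimpleGraph V :=
    { Adj := fun x y => F.Adj x y ∧ x ≠ v ∧ y ≠ v
      symm := ⟨fun x y h => ⟨h.1.symm, h.2.2, h.2.1⟩⟩
      loopless := ⟨fun x h => F.loopless.irrefl x h.1⟩ }
  obtain ⟨c, hc⟩ := hmin H (lt_of_le_of_ne (fun x y h => h.1) fun h => by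
    have : H.Adj v a := h.symm ▸ hva
    exact this.2.1 rfl)
  have hav := hva.ne'
  have hbv := hvb.ne'
  have hdv := hvd.ne'
  have hcabd := hc a b d ⟨hab, hav, hbv⟩ ⟨hbd, hbv, hdv⟩ ⟨had, hav, hdv⟩
  -- One solution gives each edge at `v` the colour of the opposite edge in the K₄.
  have hext : ∀ α β δ : Bool, ¬ (α = β ∧ β = δ) → ∃ x y z : Bool,
      ¬ (x = α ∧ α = y) ∧ ¬ (y = β ∧ β = z) ∧ ¬ (x = δ ∧ δ = z) := by decide
  obtain ⟨x, y, z, hxy, hyz, hxz⟩ := hext _ _ _ hcabd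
  set c' : Sym2 V → Bool := fun e =>
    if v ∈ e then (if a ∈ e then x else if b ∈ e then y else z) else c e with hc'
  have ha : c' s(v, a) = x := by simp [hc']
  have hb : c' s(v, b) = y := by simp [hc', hav, hab.ne]
  have hd : c' s(v, d) = z := by simp [hc', hav, had.ne, hbv, hdb.symm]
  have hrest : ∀ p q, p ≠ v → q ≠ v → c' s(p, q) = c s(p, q) := by
    intro p q hp hq; simp [hc', hp.symm, hq.symm]
  have hmain : ∀ p q, F.Adj v p → F.Adj p q → F.Adj v q → ¬ TriangleMono c' v p q := by
    intro p q hp hpq hq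
    rw [TriangleMono, hrest p q hp.ne' hq.ne']
    have hne := hpq.ne
    rcases hN p hp with rfl | rfl | rfl <;> rcases hN q hq with rfl | rfl | rfl <;>
      first
      | exact absurd rfl hne
      | simp only [ha, hb, hd]
    · exact hxy
    · exact hxz
    · rw [Sym2.eq_swap]; exact fun h => hxy ⟨h.2.symm, h.1.symm⟩
    · exact hyz
    · rw [Sym2.eq_swap]; exact fun h => hxz ⟨h.2.symm, h.1.symm⟩
    · rw [Sym2.eq_swap]; exact fun h => hyz ⟨h.2.symm, h.1.symm⟩
  refine hF ⟨c', fun p q r hpq hqr hpr hm => ?_⟩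
  by_cases h1 : p = v
  · subst h1; exact hmain q r hpq hqr hpr hm
  by_cases h2 : q = v
  · subst h2; exact hmain r p hqr hpr.symm hpq.symm hm.rotate
  by_cases h3 : r = v
  · subst h3; exact hmain p q hpr.symm hpq hqr.symm hm.rotate.rotate
  refine hc p q r ⟨hpq, h1, h2⟩ ⟨hqr, h2, h3⟩ ⟨hpr, h1, h3⟩ ?_
  rw [TriangleMono, hrest p q h1 h2, hrest q r h2 h3, hrest p r h1 h3] at hm
  exact hm

/-- Otherwise the edges inside `U` and the remaining edges form proper subgraphs. Since `U` is
closed, no triangle uses both kinds, so colourings of the two combine. -/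
lemma mem_of_adj_of_critical (hF : ¬ TriangleColorable F)
    (hmin : ∀ F' < F, TriangleColorable F') {U : Finset V} {u v : V} (huv : F.Adj u v) (hu : u ∈ U)
    (hv : v ∈ U) (hU : ∀ x ∈ U, ∀ y ∈ U, F.Adj x y → ∀ w, F.Adj x w → F.Adj y w → w ∈ U)
    {x y : V} (hxy : F.Adj x y) : x ∈ U ∧ y ∈ U := by
  by_contra hcon
  let H₁ : SimpleGraph V :=
    { Adj := fun a b => F.Adj a b ∧ (a ∈ U ∧ b ∈ U)
      symm := ⟨fun a b h => ⟨h.1.symm, h.2.symm⟩⟩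
      loopless := ⟨fun a h => F.loopless.irrefl a h.1⟩ }
  let H₂ : SimpleGraph V :=
    { Adj := fun a b => F.Adj a b ∧ ¬ (a ∈ U ∧ b ∈ U)
      symm := ⟨fun a b h => ⟨h.1.symm, fun h' => h.2 h'.symm⟩⟩
      loopless := ⟨fun a h => F.loopless.irrefl a h.1⟩ }
  obtain ⟨c₁, hc₁⟩ := hmin H₁ (lt_of_le_of_ne (fun a b h => h.1) fun h => by
    have : H₁.Adj x y := h.symm ▸ hxy
    exact hcon this.2)
  obtain ⟨c₂, hc₂⟩ := hmin H₂ (lt_of_le_of_ne (fun a b h => h.1) fun h => by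
    have : H₂.Adj u v := h.symm ▸ huv
    exact this.2 ⟨hu, hv⟩)
  set c : Sym2 V → Bool := fun e => if ∀ v ∈ e, v ∈ U then c₁ e else c₂ e with hc
  have hc1 : ∀ a b, a ∈ U ∧ b ∈ U → c s(a, b) = c₁ s(a, b) := by
    intro a b h; simp [hc, h.1, h.2]
  have hc2 : ∀ a b, ¬ (a ∈ U ∧ b ∈ U) → c s(a, b) = c₂ s(a, b) := by
    intro a b h
    simp only [hc, Sym2.mem_iff, forall_eq_or_imp, forall_eq, h, if_false]
  refine hF ⟨c, fun a b d hab hbd had hm => ?_⟩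
  by_cases hin : (a ∈ U ∧ b ∈ U) ∨ (b ∈ U ∧ d ∈ U) ∨ (a ∈ U ∧ d ∈ U)
  · have hall : a ∈ U ∧ b ∈ U ∧ d ∈ U := by
      rcases hin with h | h | h
      · exact ⟨h.1, h.2, hU a h.1 b h.2 hab d had hbd⟩
      · exact ⟨hU b h.1 d h.2 hbd a hab.symm had.symm, h.1, h.2⟩
      · exact ⟨h.1, hU a h.1 d h.2 had b hab hbd.symm, h.2⟩
    obtain ⟨ha, hb, hd⟩ := hall
    rw [TriangleMono, hc1 a b ⟨ha, hb⟩, hc1 b d ⟨hb, hd⟩, hc1 a d ⟨ha, hd⟩] at hm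
    exact hc₁ a b d ⟨hab, ha, hb⟩ ⟨hbd, hb, hd⟩ ⟨had, ha, hd⟩ hm
  · push Not at hin
    have h1 : ¬ (a ∈ U ∧ b ∈ U) := fun h => hin.1 h.1 h.2
    have h2 : ¬ (b ∈ U ∧ d ∈ U) := fun h => hin.2.1 h.1 h.2
    have h3 : ¬ (a ∈ U ∧ d ∈ U) := fun h => hin.2.2 h.1 h.2
    rw [TriangleMono, hc2 a b h1, hc2 b d h2, hc2 a d h3] at hm
    exact hc₂ a b d ⟨hab, h1⟩ ⟨hbd, h2⟩ ⟨had, h3⟩ hm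

end Critical

/-- Locally sparse graphs do not have the Ramsey property for triangles. -/
theorem triangleColorable_of_locallySparse {R : SimpleGraph V} (hR : LocallySparse R) :
    TriangleColorable R := by
  classical
  by_contra hcon
  obtain ⟨F, ⟨hFR, hF⟩, hmin'⟩ := wellFounded_lt.has_min
    {F : SimpleGraph V | F ≤ R ∧ ¬ TriangleColorable F} ⟨R, le_rfl, hcon⟩
  have hmin : ∀ F' < F, TriangleColorable F' := fun F' h => by
    by_contra h'; exact hmin' F' ⟨h.le.trans hFR, h'⟩ h
  have hempty := eq_empty_of_locallySparse hR hFR (r := 3) (s := 2)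
    (𝓑 := univ.filter fun B => F.IsNClique 3 B) (by norm_num) (by norm_num) (by norm_num)
    (by intro i h1 h2; interval_cases i; decide) (by decide)
    (fun B hB => (mem_filter.1 hB).2.1) (fun B hB => (mem_filter.1 hB).2.2) ?_ ?_
  · refine hF ⟨fun _ => true, fun a b d hab hbd had _ => ?_⟩
    have : ({a, b, d} : Finset V) ∈ univ.filter fun B => F.IsNClique 3 B :=
      mem_filter.2 ⟨mem_univ _, SimpleGraph.is3Clique_triple_iff.2 ⟨hab, had, hbd⟩⟩
    rw [hempty] at this
    simp at this
  · intro B₀ hB₀ w hw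
    obtain ⟨hcl, hcard⟩ := (mem_filter.1 hB₀).2
    obtain ⟨u, v, huv, hB₀e⟩ := card_eq_two.1
      (show #(B₀.erase w) = 2 by rw [card_erase_of_mem hw, hcard])
    have hu : u ∈ B₀.erase w := by simp [hB₀e]
    have hB₀w : B₀ = {w, u, v} := by rw [← hB₀e, insert_erase hw]
    have hwu : F.Adj w u := hcl hw (mem_of_mem_erase hu) (ne_of_mem_erase hu).symm
    obtain ⟨y, hyv, hwy, huy⟩ := exists_ne_adj_adj_of_critical hF hmin hwu v
    refine ⟨{w, u, y}, mem_filter.2 ⟨mem_univ _,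
      SimpleGraph.is3Clique_triple_iff.2 ⟨hwu, hwy, huy⟩⟩, fun h => ?_, by simp, ?_⟩
    · have hy : y ∈ B₀ := h ▸ (by simp)
      rw [hB₀w] at hy
      simp only [mem_insert, mem_singleton] at hy
      rcases hy with rfl | rfl | rfl
      exacts [hwy.ne rfl, huy.ne rfl, hyv rfl]
    · rw [← card_pair hwu.ne]
      refine card_le_card fun z hz => ?_
      rw [hB₀w]
      simp only [mem_insert, mem_singleton, mem_inter] at hz ⊢
      tauto
  -- A closed set containing a triangle contains every edge of `F`, and criticality gives its
  -- vertices degree at least four.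
  · intro U ⟨B, hB, hBU⟩ hcov hcl
    obtain ⟨hBc, hB3⟩ := (mem_filter.1 hB).2
    obtain ⟨u, v, w, huv, -, -, rfl⟩ := card_eq_three.1 hB3
    have hadj : F.Adj u v := hBc (by simp) (by simp) huv
    have hall : ∀ {x y : V}, F.Adj x y → x ∈ U ∧ y ∈ U := fun hxy =>
      mem_of_adj_of_critical hF hmin hadj (hBU (by simp)) (hBU (by simp)) (by
        intro x hx y hy hxy w hxw hyw
        refine hcl {x, y, w} (mem_filter.2 ⟨mem_univ _,
          SimpleGraph.is3Clique_triple_iff.2 ⟨hxy, hxw, hyw⟩⟩) ?_ (by simp)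
        rw [← card_pair hxy.ne]
        refine card_le_card fun z hz => ?_
        simp only [mem_insert, mem_singleton, mem_inter] at hz ⊢
        rcases hz with rfl | rfl
        exacts [⟨Or.inl rfl, hx⟩, ⟨Or.inr (Or.inl rfl), hy⟩]) hxy
    refine two_mul_card_le_card_edgesInside fun v hv => ?_
    obtain ⟨B', hB', hvB', -⟩ := hcov v hv
    obtain ⟨hB'c, hB'3⟩ := (mem_filter.1 hB').2
    obtain ⟨a, ha⟩ : (B'.erase v).Nonempty :=
      card_pos.1 (by rw [card_erase_of_mem hvB', hB'3]; norm_num)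
    have hva : F.Adj v a := hB'c hvB' (mem_of_mem_erase ha) (ne_of_mem_erase ha).symm
    refine ⟨F.neighborFinset v, fun w hw => (hall ((F.mem_neighborFinset v w).1 hw)).2, ?_,
      fun w hw => (F.mem_neighborFinset v w).1 hw⟩
    rw [SimpleGraph.card_neighborFinset_eq_degree]
    exact four_le_degree_of_critical hF hmin hva

/-- The vertices and the pairs of vertices can be coloured so that pairs of vertices of the same
colour receive that colour, and every member of `𝒬` contains pairs of both colours. -/
def CompatiblyColorable (𝒬 : Finset (Finset V)) : Prop :=
  ∃ (X : V → Bool) (c : Sym2 V → Bool), (∀ a b, X a = X b → c s(a, b) = X a) ∧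
    ∀ Q ∈ 𝒬, ∀ κ, ∃ a ∈ Q, ∃ b ∈ Q, a ≠ b ∧ c s(a, b) = κ

/-- The four-cliques of locally sparse graphs are compatibly colourable. -/
theorem compatiblyColorable_of_locallySparse {R : SimpleGraph V} (hR : LocallySparse R)
    (𝒬₀ : Finset (Finset V)) (h𝒬₀ : ∀ Q ∈ 𝒬₀, R.IsNClique 4 Q) : CompatiblyColorable 𝒬₀ := by
  classical
  by_contra hcon
  obtain ⟨𝒬, ⟨h𝒬sub, h𝒬⟩, hmin⟩ := wellFounded_lt.has_min
    {𝒬 : Finset (Finset V) | 𝒬 ⊆ 𝒬₀ ∧ ¬ CompatiblyColorable 𝒬} ⟨𝒬₀, subset_rfl, hcon⟩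
  have hQR : ∀ Q ∈ 𝒬, R.IsNClique 4 Q := fun Q hQ => h𝒬₀ Q (h𝒬sub hQ)
  have hnext : ∀ B₀ ∈ 𝒬, ∀ w ∈ B₀, ∃ B ∈ 𝒬, B ≠ B₀ ∧ w ∈ B := by
    intro B₀ hB₀ w hw
    by_contra hno
    push Not at hno
    obtain ⟨X, c, hX, hc⟩ : CompatiblyColorable (𝒬.erase B₀) := by
      by_contra h
      exact hmin _ ⟨(erase_subset _ _).trans h𝒬sub, h⟩ (erase_ssubset hB₀)
    -- Two of the three other vertices share a colour, which their pair then has; giving `w` and all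
    -- pairs at `w` the opposite colour repairs `B₀` without touching the other cliques.
    obtain ⟨a, ha, b, hb, hab, hXab⟩ := exists_ne_map_eq_of_card_lt_of_maps_to
      (s := B₀.erase w) (t := (univ : Finset Bool)) (f := X)
      (by rw [card_erase_of_mem hw, (hQR B₀ hB₀).2]; decide) (fun _ _ => mem_coe.2 (mem_univ _))
    have haw := ne_of_mem_erase ha
    have hbw := ne_of_mem_erase hb
    set c' : Sym2 V → Bool := fun e => if w ∈ e then !X a else c e with hc'
    have hc'w : ∀ y, c' s(w, y) = !X a := by intro y; simp [hc']
    have hc'w' : ∀ y, c' s(y, w) = !X a := by intro y; simp [hc']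
    have hrest : ∀ p q, p ≠ w → q ≠ w → c' s(p, q) = c s(p, q) := by
      intro p q hp hq; simp [hc', hp.symm, hq.symm]
    refine h𝒬 ⟨Function.update X w (!X a), c', fun p q hpq => ?_, fun Q hQ κ => ?_⟩
    · by_cases hp : p = w
      · subst hp; rw [hc'w, Function.update_self]
      by_cases hq : q = w
      · subst hq; rw [hc'w', hpq, Function.update_self]
      rw [Function.update_of_ne hp, Function.update_of_ne hq] at hpq
      rw [Function.update_of_ne hp, hrest p q hp hq]
      exact hX p q hpq
    · by_cases hQB : Q = B₀
      · subst hQB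
        by_cases hκ : κ = X a
        · refine ⟨a, mem_of_mem_erase ha, b, mem_of_mem_erase hb, hab, ?_⟩
          rw [hrest a b haw hbw, hX a b hXab, hκ]
        · refine ⟨w, hw, a, mem_of_mem_erase ha, haw.symm, ?_⟩
          rw [hc'w]
          exact (Bool.eq_not_of_ne hκ).symm
      · obtain ⟨p, hp, q, hq, hpq, hcpq⟩ := hc Q (mem_erase.2 ⟨hQB, hQ⟩) κ
        have hwQ := hno Q hQ hQB
        refine ⟨p, hp, q, hq, hpq, ?_⟩
        rw [hrest p q (fun h => hwQ (h ▸ hp)) (fun h => hwQ (h ▸ hq)), hcpq]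
  let F : SimpleGraph V :=
    { Adj := fun a b => a ≠ b ∧ ∃ Q ∈ 𝒬, a ∈ Q ∧ b ∈ Q
      symm := ⟨fun a b ⟨h, Q, hQ, ha, hb⟩ => ⟨h.symm, Q, hQ, hb, ha⟩⟩
      loopless := ⟨fun a h => h.1 rfl⟩ }
  have hFR : F ≤ R := fun a b ⟨h, Q, hQ, ha, hb⟩ => (hQR Q hQ).1 ha hb h
  have hempty := eq_empty_of_locallySparse hR hFR (r := 4) (s := 1) (𝓑 := 𝒬) (by norm_num)
    (by norm_num) (by norm_num) (by intro i h1 h2; interval_cases i <;> decide) (by decide)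
    (fun B hB a ha b hb hab => ⟨hab, B, hB, ha, hb⟩) (fun B hB => (hQR B hB).2) ?_ ?_
  · refine h𝒬 ⟨fun _ => true, fun _ => true, fun _ _ _ => rfl, fun Q hQ => ?_⟩
    rw [hempty] at hQ; simp at hQ
  · intro B₀ hB₀ w hw
    obtain ⟨B, hB, hne, hwB⟩ := hnext B₀ hB₀ w hw
    exact ⟨B, hB, hne, hwB, card_pos.2 ⟨w, mem_inter.2 ⟨hwB, hw⟩⟩⟩
  -- Two distinct cliques through `v` have a union of at least five vertices in `U`, giving `v` four
  -- neighbours there.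
  · intro U _ hcov hcl
    refine two_mul_card_le_card_edgesInside fun v hv => ?_
    obtain ⟨B, hB, hvB, hBU⟩ := hcov v hv
    obtain ⟨B', hB', hne, hvB'⟩ := hnext B hB v hvB
    have hB'U := hcl B' hB' (card_pos.2 ⟨v, mem_inter.2 ⟨hvB', hv⟩⟩)
    refine ⟨(B ∪ B').erase v, (erase_subset _ _).trans (union_subset hBU hB'U), ?_, ?_⟩
    · rw [card_erase_of_mem (mem_union_left _ hvB)]
      have : #B < #(B ∪ B') := card_lt_card (Finset.ssubset_iff_subset_ne.2
        ⟨subset_union_left, fun h => hne (eq_of_subset_of_card_le (by rw [h]; exact subset_union_right)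
          (by rw [(hQR B hB).2, (hQR B' hB').2]))⟩)
      rw [(hQR B hB).2] at this
      omega
    · intro w hw
      obtain ⟨hwv, hw⟩ := mem_erase.1 hw
      rcases mem_union.1 hw with h | h
      exacts [⟨hwv.symm, B, hB, hvB, h⟩, ⟨hwv.symm, B', hB', hvB', h⟩]

end Colorings

/-! ### The colouring for part (ii) -/

section Bipartite

open Finset

variable {V : Type*} [Fintype V] [DecidableEq V]

/-- The union of a bipartite graph and a locally sparse graph does not have the Ramsey property for
the complete graph on four vertices. -/
theorem not_arrows_of_locallySparse {G R : SimpleGraph V} (hR : LocallySparse R) (L : Finset V)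
    (hG : ∀ a b, G.Adj a b → (a ∈ L ↔ b ∉ L)) :
    ¬ Arrows (G ⊔ R) (SimpleGraph.completeGraph (Fin 4)) := by
  classical
  obtain ⟨c₁, hc₁⟩ := triangleColorable_of_locallySparse hR
  obtain ⟨X, c₂, hX, hc₂⟩ := compatiblyColorable_of_locallySparse hR
    (univ.filter fun Q => R.IsNClique 4 Q) fun Q hQ => (mem_filter.1 hQ).2
  set c : Sym2 V → Bool := fun e =>
    if ∀ v ∈ e, v ∈ L then c₂ e else if ∀ v ∈ e, v ∉ L then c₁ e else
      decide (∃ v ∈ e, v ∈ L ∧ X v = false) with hc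
  have hcL : ∀ a ∈ L, ∀ b ∈ L, c s(a, b) = c₂ s(a, b) := by
    intro a ha b hb; simp [hc, ha, hb]
  have hcN : ∀ a ∉ L, ∀ b ∉ L, c s(a, b) = c₁ s(a, b) := by
    intro a ha b hb; simp [hc, ha, hb]
  have hcM : ∀ a ∈ L, ∀ b ∉ L, c s(a, b) = !X a := by
    intro a ha b hb; cases h : X a <;> simp [hc, ha, hb, h]
  intro hArr
  obtain ⟨i, ⟨f⟩⟩ := hArr fun e => if c e.1 then 1 else 0
  set κ : Bool := decide (i = 1) with hκ
  set Q : Finset V := univ.image f with hQ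
  have hfinj : Function.Injective f := f.injective
  have hQ4 : #Q = 4 := by rw [hQ, card_image_of_injective _ hfinj]; rfl
  have hcol : ∀ (b : Bool) (k : Fin 2), (if b = true then (1 : Fin 2) else 0) = k →
      b = decide (k = 1) := by decide
  have hadj : ∀ a ∈ Q, ∀ b ∈ Q, a ≠ b → (G ⊔ R).Adj a b ∧ c s(a, b) = κ := by
    intro a ha b hb hab
    obtain ⟨x, -, rfl⟩ := mem_image.1 ha
    obtain ⟨y, -, rfl⟩ := mem_image.1 hb
    have hxy : (SimpleGraph.completeGraph (Fin 4)).Adj x y := fun h => hab (by rw [h])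
    have h1 := f.toHom.map_adj hxy
    obtain ⟨h2, h3⟩ := (SimpleGraph.EdgeLabeling.labelGraph_adj _ _).1 h1
    refine ⟨h2, ?_⟩
    change (if c s(f x, f y) = true then (1 : Fin 2) else 0) = i at h3
    exact hcol _ _ h3
  have hRadj : ∀ a ∈ Q, ∀ b ∈ Q, a ≠ b → (a ∈ L ↔ b ∈ L) → R.Adj a b := by
    intro a ha b hb hab hL
    refine (hadj a ha b hb hab).1.resolve_left fun h => ?_
    have := hG a b h
    tauto
  -- Equal colours on `ab` and `a'b` force X a = X a', so `aa'` has colour X a while the crossing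
  -- edges have the opposite one.
  have hmixed : ∀ a ∈ Q, ∀ a' ∈ Q, ∀ b ∈ Q, a ≠ a' → a ∈ L → a' ∈ L → b ∉ L → False := by
    intro a ha a' ha' b hb hne haL ha'L hbL
    have h1 := (hadj a ha b hb fun h => hbL (h ▸ haL)).2
    have h2 := (hadj a' ha' b hb fun h => hbL (h ▸ ha'L)).2
    have h3 := (hadj a ha a' ha' hne).2
    rw [hcM a haL b hbL] at h1
    rw [hcM a' ha'L b hbL] at h2
    have h4 : X a = X a' := Bool.not_inj (h1.trans h2.symm)
    rw [hcL a haL a' ha'L, hX a a' h4, ← h1] at h3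
    cases X a <;> simp at h3
  by_cases hall : Q ⊆ L
  · have hcl : R.IsNClique 4 Q :=
      ⟨fun a ha b hb hab => hRadj a ha b hb hab (by simp [hall ha, hall hb]), hQ4⟩
    obtain ⟨a, ha, b, hb, hab, h⟩ := hc₂ Q (mem_filter.2 ⟨mem_univ _, hcl⟩) (!κ)
    have h1 := (hadj a ha b hb hab).2
    rw [hcL a (hall ha) b (hall hb), h] at h1
    cases hk : κ <;> simp [hk] at h1
  · obtain ⟨b₀, hb₀, hb₀L⟩ := not_subset.1 hall
    have hone : #(Q ∩ L) ≤ 1 := card_le_one.2 fun a ha a' ha' => by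
      by_contra hne
      exact hmixed a (mem_inter.1 ha).1 a' (mem_inter.1 ha').1 b₀ hb₀ hne (mem_inter.1 ha).2
        (mem_inter.1 ha').2 hb₀L
    have hthree : 2 < #(Q \ L) := by
      have := card_inter_add_card_sdiff Q L
      omega
    obtain ⟨a, b, d, ha, hb, hd, hab, had, hbd⟩ := two_lt_card_iff.1 hthree
    obtain ⟨ha, haL⟩ := mem_sdiff.1 ha
    obtain ⟨hb, hbL⟩ := mem_sdiff.1 hb
    obtain ⟨hd, hdL⟩ := mem_sdiff.1 hd
    refine hc₁ a b d (hRadj a ha b hb hab (by simp [haL, hbL]))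
      (hRadj b hb d hd hbd (by simp [hbL, hdL])) (hRadj a ha d hd had (by simp [haL, hdL])) ?_
    rw [TriangleMono, ← hcN a haL b hbL, ← hcN b hbL d hdL, ← hcN a haL d hdL,
      (hadj a ha b hb hab).2, (hadj b hb d hd hbd).2, (hadj a ha d hd had).2]
    exact ⟨rfl, rfl⟩

end Bipartite

/-- The two sides of the balanced complete bipartite graph on `Fin n`. -/
def halvesEquiv (n : ℕ) : Fin ((n + 1) / 2) ⊕ Fin (n / 2) ≃ Fin n :=
  finSumFinEquiv.trans (finCongr (by omega))

/-- The balanced complete bipartite graph on `Fin n`. -/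
def balancedBipartite (n : ℕ) : SimpleGraph (Fin n) :=
  (completeBipartiteGraph (Fin ((n + 1) / 2)) (Fin (n / 2))).comap (halvesEquiv n).symm

lemma ncard_edgeSet_balancedBipartite (n : ℕ) :
    (n + 1) / 2 * (n / 2) ≤ (balancedBipartite n).edgeSet.ncard := by
  classical
  have hinj : Function.Injective fun k : Fin ((n + 1) / 2) × Fin (n / 2) =>
      s(halvesEquiv n (Sum.inl k.1), halvesEquiv n (Sum.inr k.2)) := by
    rintro ⟨a, b⟩ ⟨a', b'⟩ h
    rcases Sym2.eq_iff.1 h with ⟨h1, h2⟩ | ⟨h1, -⟩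
    · simp only [EmbeddingLike.apply_eq_iff_eq, Sum.inl.injEq, Sum.inr.injEq] at h1 h2
      rw [h1, h2]
    · simp at h1
  have hsub : Set.range (fun k : Fin ((n + 1) / 2) × Fin (n / 2) =>
      s(halvesEquiv n (Sum.inl k.1), halvesEquiv n (Sum.inr k.2))) ⊆
        (balancedBipartite n).edgeSet := by
    rintro _ ⟨⟨a, b⟩, rfl⟩
    simp [balancedBipartite]
  refine le_trans (le_of_eq ?_) (Set.ncard_le_ncard hsub (Set.toFinite _))
  rw [← Set.image_univ, Set.ncard_image_of_injective _ hinj, Set.ncard_univ]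
  simp

lemma eventually_isDense_balancedBipartite {γ : ℝ} (hγ : γ < 1 / 4) :
    ∀ᶠ n in atTop, IsDense γ (balancedBipartite n) := by
  have h1 : Tendsto (fun n : ℕ => (1 / 4 - γ) * (n : ℝ)) atTop atTop :=
    tendsto_natCast_atTop_atTop.const_mul_atTop (by linarith)
  filter_upwards [h1.eventually_ge_atTop 1, eventually_ge_atTop 1] with n hn hn1
  have hn1' : (1 : ℝ) ≤ n := by exact_mod_cast hn1
  unfold IsDense
  rw [Nat.card_eq_fintype_card, Fintype.card_fin]
  -- The parity loss of 1 is absorbed by the gap between γ and 1/4.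
  have h2 : n ^ 2 ≤ 4 * ((n + 1) / 2 * (n / 2)) + 1 := by
    rcases Nat.even_or_odd' n with ⟨k, rfl | rfl⟩
    · rw [show (2 * k + 1) / 2 = k by omega, show 2 * k / 2 = k by omega]
      nlinarith
    · rw [show (2 * k + 1 + 1) / 2 = k + 1 by omega, show (2 * k + 1) / 2 = k by omega]
      nlinarith
  have h3 := ncard_edgeSet_balancedBipartite n
  have h4 : (n : ℝ) ^ 2 ≤ 4 * ((balancedBipartite n).edgeSet.ncard : ℝ) + 1 := by
    exact_mod_cast h2.trans (by omega)
  nlinarith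

end PerturbedRamsey

theorem theorem1p5 :
    (∀ γ ε : ℝ, 0 < γ → 0 < ε →
      ∀ G : (n : ℕ) → SimpleGraph (Fin n),
        (∀ᶠ n in atTop, PerturbedRamsey.IsDense γ (G n)) →
      ∀ p : ℕ → unitInterval,
        (∀ᶠ n : ℕ in atTop, (n : ℝ) ^ (-(1 / 2 : ℝ) + ε) ≤ (p n : ℝ)) →
        PerturbedRamsey.AAS p
          (fun n R => PerturbedRamsey.Arrows (G n ⊔ R) (SimpleGraph.completeGraph (Fin 4)))) ∧
    (∀ γ : ℝ, 0 < γ → γ < 1 / 4 →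
      ∃ G : (n : ℕ) → SimpleGraph (Fin n),
        (∀ n, Nonempty (G n ≃g completeBipartiteGraph (Fin ((n + 1) / 2)) (Fin (n / 2)))) ∧
        (∀ᶠ n in atTop, PerturbedRamsey.IsDense γ (G n)) ∧
        ∀ p : ℕ → unitInterval,
          (fun n : ℕ => (p n : ℝ)) =o[atTop] (fun n : ℕ => (n : ℝ) ^ (-(1 / 2 : ℝ))) →
          PerturbedRamsey.AAS p
            (fun n R => ¬ PerturbedRamsey.Arrows (G n ⊔ R) (SimpleGraph.completeGraph (Fin 4)))) := by
  refine ⟨fun γ ε hγ hε G hG p hp => PerturbedRamsey.aas_arrows_of_isDense hγ hε G hG p hp,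
    fun γ _ hγ => ⟨PerturbedRamsey.balancedBipartite, fun n => ?_,
      PerturbedRamsey.eventually_isDense_balancedBipartite hγ, fun p hp => ?_⟩⟩
  · exact ⟨SimpleGraph.Iso.comap (PerturbedRamsey.halvesEquiv n).symm _⟩
  · have hsparse := PerturbedRamsey.aas_locallySparse hp
    refine tendsto_of_tendsto_of_tendsto_of_le_of_le hsparse tendsto_const_nhds
      (fun n => MeasureTheory.measure_mono fun R hR => ?_)
      (fun n => MeasureTheory.prob_le_one)
    refine PerturbedRamsey.not_arrows_of_locallySparse hR
      (Finset.univ.filter fun a => ((PerturbedRamsey.halvesEquiv n).symm a).isLeft) fun a b hab => ?_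
    have hab' : (completeBipartiteGraph (Fin ((n + 1) / 2)) (Fin (n / 2))).Adj
      ((PerturbedRamsey.halvesEquiv n).symm a) ((PerturbedRamsey.halvesEquiv n).symm b) := hab
    rw [completeBipartiteGraph_adj] at hab'
    simp only [Finset.mem_filter, Finset.mem_univ, true_and]
    rcases h1 : (PerturbedRamsey.halvesEquiv n).symm a with x | x <;>
      rcases h2 : (PerturbedRamsey.halvesEquiv n).symm b with y | y <;>
      simp [h1, h2] at hab' ⊢
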